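/- Let $N,s,L_R,L_T,K$ be integers with $1\le s\le N$, $L_R\ge 1$, $L_T\ge 2$, $K\ge 1$. Let $\mathbf H_1,\dots,\mathbf H_N\in\mathbb C^{L_R\times L_T}$ be independent random matrices with i.i.d. $\mathcal{CN}(0,1)$ entries (circularly symmetric complex Gaussian with mean zero and unit variance). Let $\mathbf H_{(k)}$, $1\le k\le s$, be the one with the $k$-th largest Frobenius norm, let $\mathbf v_k$ be a unit right singular vector of $\mathbf H_{(k)}$ for its largest singular value, and let $\mathbf V=[\mathbf v_1\cdots\mathbf v_s]$. Independently of the $\mathbf H_i$, let the random codebook $\mathcal B$ consist of $K$ independent, isotropically distributed codewords; a codeword is a matrix $\mathbf B=[\mathbf b_1\cdots\mathbf b_s]\in\mathbb C^{L_T\times s}$ whose columns are unit vectors, and isotropically distributed means that the columns are independent and uniform on the unit sphere of $\mathbb C^{L_T}$. Let $\varphi(\mathbf V)=[\mathbf b_1\cdots\mathbf b_s]$ be a codeword of $\mathcal B$ that maximizes $\sum_{k=1}^s|\mathbf v_k^\dagger\mathbf b_k|^2$. The order of the matrices in case of ties, the choice of the singular vectors and the choice of the maximizing codeword are arbitrary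 (measurable). For a given codebook, the power efficiency factor is $$\eta=\frac1{sL_R}\,\mathrm E_{\mathbf H}\Big[\sum_{k=1}^s\|\mathbf H_{(k)}\mathbf b_k\|^2\Big],\qquad [\mathbf b_1\cdots\mathbf b_s]=\varphi(\mathbf V).$$ Put $$\gamma=\mathrm E_{\mathcal B,\mathbf V}\Big[\sum_{k=1}^s|\mathbf v_k^\dagger\mathbf b_k|^2\Big],\qquad \bar n_{(\cdot)}^2=\frac1s\sum_{k=1}^s\mathrm E\big[\|\mathbf H_{(k)}\|^2\big]$$ (Frobenius norm), and let $\zeta_1=\mathrm E[\lambda_1\mid\mathrm{tr}(\mathbf W)=1]$, where $\lambda_1$ is the largest eigenvalue of $\mathbf W=\mathbf H\mathbf H^\dagger$ for an $L_R\times L_T$ matrix $\mathbf H$ with i.i.d. $\mathcal{CN}(0,1)$ entries; that is, $\zeta_1=\lim_{\varepsilon\downarrow0}\mathrm E\big[\lambda_1\,\big|\,|\mathrm{tr}(\mathbf W)-1|<\varepsilon\big]$. This limit exists, $\mathrm E[\lambda_1\mid\mathrm{tr}(\mathbf W)]=\zeta_1\,\mathrm{tr}(\mathbf W)$ almost surely,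 all the expectations above are finite, and $$\mathrm E_{\mathcal B}[\eta]=\frac1{sL_R}\,\mathrm E_{\mathcal B,\mathbf H}\Big[\sum_{k=1}^s\|\mathbf H_{(k)}\mathbf b_k\|^2\Big]=\frac1{L_R}\left(\frac{\gamma}{s}\,\zeta_1+\frac{s-\gamma}{s}\,\frac{1-\zeta_1}{L_T-1}\right)\bar n_{(\cdot)}^2 .$$ -/

import Mathlib

open MeasureTheory ProbabilityTheory Filter Topology

noncomputable section

namespace BeamForm

/-- The circularly symmetric complex Gaussian law with mean zero and unit variance: independent
real and imaginary parts, each centred Gaussian of variance one half. -/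
def complexGaussian : Measure ℂ :=
  ((gaussianReal 0 (1 / 2)).prod (gaussianReal 0 (1 / 2))).map Complex.measurableEquivRealProd.symm

/-- Channel state matrices with `LR` rows and `LT` columns, stored by their entries. -/
abbrev Channel (LR LT : ℕ) : Type := Fin LR → Fin LT → ℂ

/-- The law of a standard complex Gaussian matrix: i.i.d. entries. -/
def channelLaw (LR LT : ℕ) : Measure (Channel LR LT) :=
  Measure.pi fun _ => Measure.pi fun _ => complexGaussian

/-- The law of the channel state matrices of `N` users, independent across the users. -/
def systemLaw (N LR LT : ℕ) : Measure (Fin N → Channel LR LT) :=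
  Measure.pi fun _ => channelLaw LR LT

/-- The Wishart matrix `A Aᴴ`. -/
def wishart {LR LT : ℕ} (A : Channel LR LT) : Matrix (Fin LR) (Fin LR) ℂ :=
  Matrix.of A * (Matrix.of A).conjTranspose

/-- The largest eigenvalue of `A Aᴴ`. -/
def topEigenvalue {LR LT : ℕ} (A : Channel LR LT) : ℝ :=
  ⨆ i, (Matrix.isHermitian_mul_conjTranspose_self (Matrix.of A)).eigenvalues i

/-- The (real) trace of `A Aᴴ`. -/
def wishartTrace {LR LT : ℕ} (A : Channel LR LT) : ℝ := (wishart A).trace.re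

/-- The squared Frobenius norm. -/
def frobSq {LR LT : ℕ} (A : Channel LR LT) : ℝ := ∑ i, ∑ j, ‖A i j‖ ^ 2

/-- The conditional expectation of the largest eigenvalue of the Wishart matrix, given that its
trace equals one: the limit, as `ε` decreases to zero, of the elementary conditional expectations
given that the trace lies within `ε` of one. -/
def zetaOne (LR LT : ℕ) : ℝ :=
  limUnder (𝓝[>] (0 : ℝ)) fun ε : ℝ =>
    ⨍ A in {A : Channel LR LT | |wishartTrace A - 1| < ε}, topEigenvalue A ∂(channelLaw LR LT)

/-- Unit vectors in the Hermitian space `ℂ ^ LT`. -/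
abbrev UnitVec (LT : ℕ) : Type := Metric.sphere (0 : EuclideanSpace ℂ (Fin LT)) 1

/-- The isotropic probability law on unit vectors: the normalized surface measure. -/
def isotropicVec (LT : ℕ) : Measure (UnitVec LT) :=
  ((volume : Measure (EuclideanSpace ℂ (Fin LT))).toSphere Set.univ)⁻¹ •
    (volume : Measure (EuclideanSpace ℂ (Fin LT))).toSphere

/-- Composite Grassmann matrices with `s` columns, each of them a unit vector in `ℂ ^ LT`. -/
abbrev CompositeMatrix (LT s : ℕ) : Type := Fin s → UnitVec LT

/-- The isotropic law on composite Grassmann matrices: the product of the isotropic laws of the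
columns. -/
def isotropicComposite (LT s : ℕ) : Measure (CompositeMatrix LT s) :=
  Measure.pi fun _ => isotropicVec LT

/-- Codebooks consisting of `K` composite Grassmann matrices. -/
abbrev Codebook (LT s K : ℕ) : Type := Fin K → CompositeMatrix LT s

/-- The law of a random codebook: `K` independent isotropic codewords. -/
def codebookLaw (LT s K : ℕ) : Measure (Codebook LT s K) :=
  Measure.pi fun _ => isotropicComposite LT s

/-- `σ 0, σ 1, …` are the users with the largest, second largest, … Frobenius norm of the channel
state matrix. -/
structure IsUserSelection {N s LR LT : ℕ} (H : Fin N → Channel LR LT) (σ : Fin s → Fin N) :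
    Prop where
  injective : Function.Injective σ
  antitone : Antitone fun k => frobSq (H (σ k))
  unselected_le : ∀ i, i ∉ Set.range σ → ∀ k, frobSq (H i) ≤ frobSq (H (σ k))

/-- `v` is a (unit) right singular vector of `A` for its largest singular value, whose square is
the largest eigenvalue of `A Aᴴ`. -/
def IsTopRightSingularVector {LR LT : ℕ} (A : Channel LR LT) (v : UnitVec LT) : Prop :=
  ((Matrix.of A).conjTranspose * Matrix.of A).mulVec v.1.ofLp =
    (topEigenvalue A : ℂ) • v.1.ofLp

/-- The sum over the columns of `|vₖ† bₖ|²`. -/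
def gain {LT s : ℕ} (V B : CompositeMatrix LT s) : ℝ :=
  ∑ k, ‖inner ℂ (V k).1 (B k).1‖ ^ 2

/-- `φ` is a quantization function: it sends a codebook and a matrix `V` to the index of a codeword
that maximizes the gain. -/
def IsJointQuantizer {LT s K : ℕ} (φ : Codebook LT s K → CompositeMatrix LT s → Fin K) : Prop :=
  ∀ (B : Codebook LT s K) (V : CompositeMatrix LT s) (j : Fin K),
    gain V (B j) ≤ gain V (B (φ B V))

/-- The squared norm of the vector `A b`. -/
def equivChannelSq {LR LT : ℕ} (A : Channel LR LT) (b : UnitVec LT) : ℝ :=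
  ∑ i, ‖(Matrix.of A).mulVec b.1.ofLp i‖ ^ 2

section Scheme

variable {N s LR LT K : ℕ}

/-- The sum over the selected users of the squared norms of their equivalent channel vectors. -/
def totalPower (sel : (Fin N → Channel LR LT) → Fin s → Fin N)
    (v : (Fin N → Channel LR LT) → CompositeMatrix LT s)
    (φ : Codebook LT s K → CompositeMatrix LT s → Fin K)
    (B : Codebook LT s K) (H : Fin N → Channel LR LT) : ℝ :=
  ∑ k, equivChannelSq (H (sel H k)) (B (φ B (v H)) k)

/-- The power efficiency factor for a given codebook. -/
def powerEfficiency (sel : (Fin N → Channel LR LT) → Fin s → Fin N)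
    (v : (Fin N → Channel LR LT) → CompositeMatrix LT s)
    (φ : Codebook LT s K → CompositeMatrix LT s → Fin K) (B : Codebook LT s K) : ℝ :=
  1 / (s * LR) * ∫ H, totalPower sel v φ B H ∂(systemLaw N LR LT)

/-- The gain of the selected codeword. -/
def selectedGain (v : (Fin N → Channel LR LT) → CompositeMatrix LT s)
    (φ : Codebook LT s K → CompositeMatrix LT s → Fin K)
    (B : Codebook LT s K) (H : Fin N → Channel LR LT) : ℝ :=
  gain (v H) (B (φ B (v H)))

/-- The expected gain of the selected codeword, over the random codebook and the channels. -/
def expectedGain (v : (Fin N → Channel LR LT) → CompositeMatrix LT s)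
    (φ : Codebook LT s K → CompositeMatrix LT s → Fin K) : ℝ :=
  ∫ p, selectedGain v φ p.1 p.2 ∂((codebookLaw LT s K).prod (systemLaw N LR LT))

/-- The average over the selected users of the expected squared Frobenius norms. -/
def meanSelectedSq (sel : (Fin N → Channel LR LT) → Fin s → Fin N) : ℝ :=
  1 / s * ∑ k, ∫ H, frobSq (H (sel H k)) ∂(systemLaw N LR LT)

end Scheme

end BeamForm

end

open BeamForm

noncomputable section

namespace BeamForm

open scoped ENNReal Pointwise

/-! The formula separates into an average over the codebook for fixed channels and an average over
the channels.

Codebook: for fixed `V`, let Q(h) be the second moment of h† b_k, where b_k is the `k`-th column of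
the selected codeword. Applying a unitary map that fixes v_k to the `k`-th column of all codewords
preserves the codebook law and every gain. Ties have probability zero, so it almost surely leaves
the selected index unchanged. Hence Q is a quadratic form of trace one, invariant under the
stabilizer of v_k: it equals some a on the line of v_k and (1 - a)/(LT - 1) on its orthogonal
complement (`secondMoment_eq_of_invariant`, `secondMoment_selectedColumn_eq`). General rotations and
permutations of the columns show that a depends neither on `V` nor on `k`, so a = γ/s. Summing Q
over the conjugated rows of a channel matrix `A` with top singular vector v_k gives a λ₁ + (1 -
a)/(LT - 1) (‖A‖² - λ₁) (`integral_equivChannelSq_selected`).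

Channels: the Gaussian density is radial and λ₁ is homogeneous of degree two. In polar coordinates
λ₁ is therefore a fixed multiple of ‖A‖² on average against any function of the norm, and the
multiple is ζ₁ (`tendsto_zetaOne_and_lintegral`). User selection depends almost surely only on the
norms, so E λ₁(H_(k)) = ζ₁ E ‖H_(k)‖² (`integral_topEigenvalue_selected`). -/

/-! ### Top eigenvalue, Frobenius norm and equivalent channel. -/

lemma frobSq_nonneg {LR LT : ℕ} (A : Channel LR LT) : 0 ≤ frobSq A :=
  Finset.sum_nonneg fun _ _ => Finset.sum_nonneg fun _ _ => sq_nonneg _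

lemma continuous_frobSq {LR LT : ℕ} : Continuous (frobSq (LR := LR) (LT := LT)) := by
  unfold frobSq
  fun_prop

lemma trace_wishart {LR LT : ℕ} (A : Channel LR LT) : (wishart A).trace = (frobSq A : ℂ) := by
  simp [wishart, frobSq, Matrix.trace, Matrix.mul_apply, Complex.mul_conj, Complex.normSq_eq_norm_sq]

lemma wishartTrace_eq_frobSq {LR LT : ℕ} (A : Channel LR LT) : wishartTrace A = frobSq A := by
  simp [wishartTrace, trace_wishart]

open scoped Matrix.Norms.L2Operator ComplexOrder in
/-- The largest eigenvalue of a positive semidefinite matrix is its operator norm. -/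
lemma _root_.Matrix.PosSemidef.iSup_eigenvalues_eq_norm {n : Type*} [Fintype n] [DecidableEq n]
    {M : Matrix n n ℂ} (hM : M.PosSemidef) (h : M.IsHermitian) :
    ⨆ i, h.eigenvalues i = ‖M‖ := by
  have h1 : ‖M‖ = ‖(fun i => (h.eigenvalues i : ℂ))‖ := by
    conv_lhs => rw [h.spectral_theorem]
    rw [Unitary.conjStarAlgAut_apply, ← Unitary.coe_star, CStarRing.norm_mul_coe_unitary, CStarRing.norm_coe_unitary_mul,
      Matrix.l2_opNorm_diagonal]
    rfl
  rw [h1]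
  have h0 : ∀ i, 0 ≤ h.eigenvalues i := hM.eigenvalues_nonneg
  apply le_antisymm
  · refine Real.iSup_le (fun i => ?_) (norm_nonneg _)
    refine le_trans (le_of_eq ?_) (norm_le_pi_norm _ i)
    simp [abs_of_nonneg (h0 i)]
  · refine (pi_norm_le_iff_of_nonneg (Real.iSup_nonneg h0)).2 fun i => ?_
    rw [Complex.norm_real, Real.norm_of_nonneg (h0 i)]
    exact le_ciSup (Set.finite_range _).bddAbove i

-- Continuity and degree-two homogeneity of the top eigenvalue are read off from the operator norm.
open scoped Matrix.Norms.L2Operator ComplexOrder in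
lemma topEigenvalue_eq_norm {LR LT : ℕ} (A : Channel LR LT) : topEigenvalue A = ‖wishart A‖ :=
  (Matrix.posSemidef_self_mul_conjTranspose (Matrix.of A)).iSup_eigenvalues_eq_norm _

open scoped Matrix.Norms.L2Operator ComplexOrder in
lemma continuous_topEigenvalue {LR LT : ℕ} : Continuous (topEigenvalue (LR := LR) (LT := LT)) := by
  simp_rw [funext (topEigenvalue_eq_norm (LR := LR) (LT := LT))]
  refine Continuous.norm (E := Matrix (Fin LR) (Fin LR) ℂ) ?_
  unfold wishart
  have h : Continuous fun A : Channel LR LT => Matrix.of A := continuous_id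
  exact h.matrix_mul h.matrix_conjTranspose

open scoped Matrix.Norms.L2Operator ComplexOrder in
lemma topEigenvalue_nonneg {LR LT : ℕ} (A : Channel LR LT) : 0 ≤ topEigenvalue A := by
  rw [topEigenvalue_eq_norm]
  exact norm_nonneg (E := Matrix (Fin LR) (Fin LR) ℂ) _

open scoped Matrix.Norms.L2Operator ComplexOrder in
lemma topEigenvalue_smul {LR LT : ℕ} (r : ℝ) (A : Channel LR LT) :
    topEigenvalue (r • A) = r ^ 2 * topEigenvalue A := by
  have : wishart (r • A) = ((r : ℂ) ^ 2) • wishart A := by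
    ext i j
    simp only [wishart, Matrix.mul_apply, Matrix.smul_apply, Finset.smul_sum]
    refine Finset.sum_congr rfl fun k _ => ?_
    simp
    ring
  rw [topEigenvalue_eq_norm, topEigenvalue_eq_norm, this, norm_smul]
  simp

open scoped Matrix.Norms.L2Operator ComplexOrder in
lemma topEigenvalue_le_frobSq {LR LT : ℕ} (A : Channel LR LT) : topEigenvalue A ≤ frobSq A := by
  have hA := Matrix.isHermitian_mul_conjTranspose_self (Matrix.of A)
  have h0 : ∀ i, 0 ≤ hA.eigenvalues i :=
    (Matrix.posSemidef_self_mul_conjTranspose (Matrix.of A)).eigenvalues_nonneg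
  have htr : frobSq A = ∑ i, hA.eigenvalues i := by
    have := (trace_wishart A).symm.trans hA.trace_eq_sum_eigenvalues
    rw [← Complex.ofReal_inj, this, Complex.ofReal_sum]
    rfl
  refine Real.iSup_le (fun i => ?_) (frobSq_nonneg A)
  rw [htr]
  exact Finset.single_le_sum (fun j _ => h0 j) (Finset.mem_univ i)

/-- The vector `h` with `h† b` equal to the `i`-th entry of `A b`. -/
def conjRow {LR LT : ℕ} (A : Channel LR LT) (i : Fin LR) : EuclideanSpace ℂ (Fin LT) :=
  WithLp.toLp 2 (star (A i))

lemma equivChannelSq_eq_sum_inner {LR LT : ℕ} (A : Channel LR LT) (b : UnitVec LT) :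
    equivChannelSq A b = ∑ i, ‖inner ℂ (conjRow A i) b.1‖ ^ 2 := by
  refine Finset.sum_congr rfl fun i _ => ?_
  congr 2
  simp [conjRow, PiLp.inner_apply, Matrix.mulVec, dotProduct, mul_comm]

lemma sum_norm_conjRow_sq {LR LT : ℕ} (A : Channel LR LT) :
    ∑ i, ‖conjRow A i‖ ^ 2 = frobSq A := by
  simp [conjRow, EuclideanSpace.norm_sq_eq, frobSq]

lemma equivChannelSq_of_isTopRightSingularVector {LR LT : ℕ} {A : Channel LR LT} {v : UnitVec LT}
    (h : IsTopRightSingularVector A v) : equivChannelSq A v = topEigenvalue A := by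
  have h1 : ((equivChannelSq A v : ℝ) : ℂ) =
      dotProduct (star v.1.ofLp)
        (((Matrix.of A).conjTranspose * Matrix.of A).mulVec v.1.ofLp) := by
    rw [← Matrix.mulVec_mulVec, Matrix.dotProduct_mulVec, ← Matrix.star_mulVec]
    simp only [equivChannelSq, dotProduct, Pi.star_apply, Complex.ofReal_sum]
    refine Finset.sum_congr rfl fun i _ => ?_
    rw [mul_comm, RCLike.star_def, Complex.mul_conj, Complex.normSq_eq_norm_sq]
  rw [h, dotProduct_smul] at h1
  have h2 : dotProduct (star v.1.ofLp) v.1.ofLp = 1 := by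
    have h3 : ‖v.1‖ = 1 := by simp
    have h4 : inner ℂ v.1 v.1 = (1 : ℂ) := by rw [inner_self_eq_norm_sq_to_K, h3]; simp
    rw [EuclideanSpace.inner_eq_star_dotProduct] at h4
    rw [← h4, dotProduct_comm]
  rw [h2] at h1
  simp only [smul_eq_mul, mul_one] at h1
  exact_mod_cast h1

/-! ### The Gaussian law has a radial density. -/

lemma map_withDensity_comp {α β : Type*} [MeasurableSpace α] [MeasurableSpace β] {μ : Measure α}
    {ν : Measure β} {g : α → β} (hg : MeasurePreserving g μ ν) {f : β → ℝ≥0∞}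
    (hf : Measurable f) : (μ.withDensity (f ∘ g)).map g = ν.withDensity f := by
  ext s hs
  rw [Measure.map_apply hg.measurable hs, withDensity_apply _ (hg.measurable hs),
    withDensity_apply _ hs, ← hg.setLIntegral_comp_preimage hs hf]
  rfl

lemma lintegral_fin_prod {α : Type*} [MeasurableSpace α] (μ : Measure α) [SigmaFinite μ] {n : ℕ}
    {g : Fin n → α → ℝ≥0∞} (hg : ∀ i, Measurable (g i)) :
    ∫⁻ x, ∏ i, g i (x i) ∂(Measure.pi fun _ : Fin n => μ) = ∏ i, ∫⁻ x, g i x ∂μ := by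
  induction n with
  | zero => simp
  | succ n ih =>
    rw [← (measurePreserving_piFinSuccAbove (fun _ : Fin (n + 1) => μ) 0).symm.lintegral_comp
      (by fun_prop)]
    simp only [MeasurableEquiv.piFinSuccAbove_symm_apply, Fin.prod_univ_succ, 
      Fin.insertNthEquiv_zero, Fin.consEquiv_apply, Fin.cons_zero, Fin.cons_succ]
    rw [lintegral_prod_mul (f := g 0) (g := fun y : Fin n → α => ∏ i : Fin n, g i.succ (y i))
      (hg 0).aemeasurable (Finset.measurable_prod _ fun i _ =>
        (hg i.succ).comp (measurable_pi_apply i)).aemeasurable]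
    rw [← ih fun i => hg i.succ]

lemma pi_withDensity_fin {α : Type*} [MeasurableSpace α] (μ : Measure α) [SigmaFinite μ] {n : ℕ}
    {f : α → ℝ≥0∞} (hf : Measurable f) [SigmaFinite (μ.withDensity f)] :
    (Measure.pi fun _ : Fin n => μ.withDensity f) =
      (Measure.pi fun _ : Fin n => μ).withDensity fun x => ∏ i, f (x i) := by
  refine Measure.pi_eq fun s hs => ?_
  rw [withDensity_apply _ (MeasurableSet.univ_pi hs), ← lintegral_indicator (MeasurableSet.univ_pi hs)]
  have h : ∀ x : Fin n → α, (Set.univ.pi s).indicator (fun x => ∏ i, f (x i)) x =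
      ∏ i, (s i).indicator f (x i) := by
    intro x
    by_cases hx : x ∈ Set.univ.pi s
    · rw [Set.indicator_of_mem hx]
      exact Finset.prod_congr rfl fun i _ => (Set.indicator_of_mem (hx i trivial) _).symm
    · rw [Set.indicator_of_notMem hx]
      simp only [Set.mem_pi, Set.mem_univ, true_implies, not_forall] at hx
      obtain ⟨i, hi⟩ := hx
      exact (Finset.prod_eq_zero (Finset.mem_univ i) (Set.indicator_of_notMem hi _)).symm
  simp_rw [h]
  rw [lintegral_fin_prod μ fun i => hf.indicator (hs i)]
  refine Finset.prod_congr rfl fun i _ => ?_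
  rw [withDensity_apply _ (hs i), lintegral_indicator (hs i)]

/-- The density of the standard complex Gaussian law. -/
def complexGaussianDensity (z : ℂ) : ℝ≥0∞ := ENNReal.ofReal (Real.pi⁻¹ * Real.exp (-‖z‖ ^ 2))

lemma measurable_complexGaussianDensity : Measurable complexGaussianDensity := by
  unfold complexGaussianDensity
  fun_prop

lemma complexGaussian_eq_withDensity :
    complexGaussian = volume.withDensity complexGaussianDensity := by
  have hv : (1 / 2 : NNReal) ≠ 0 := by norm_num
  rw [← map_withDensity_comp Complex.volume_preserving_equiv_real_prod.symm
    measurable_complexGaussianDensity]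
  unfold complexGaussian
  rw [gaussianReal_of_var_ne_zero _ hv,
    prod_withDensity (measurable_gaussianPDF _ _) (measurable_gaussianPDF _ _)]
  congr 2
  funext z
  simp only [gaussianPDF, gaussianPDFReal, complexGaussianDensity, Function.comp]
  rw [← ENNReal.ofReal_mul (by positivity)]
  congr 1
  have h1 : (2 * Real.pi * ((1 / 2 : NNReal) : ℝ)) = Real.pi := by push_cast; ring
  have h2 : (2 * ((1 / 2 : NNReal) : ℝ)) = 1 := by push_cast; norm_num
  have h3 : ‖Complex.measurableEquivRealProd.symm z‖ ^ 2 = z.1 ^ 2 + z.2 ^ 2 := by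
    rw [← Complex.normSq_eq_norm_sq, Complex.normSq_apply]
    simp [Complex.measurableEquivRealProd, sq]
  have h4 : Real.pi⁻¹ = (√Real.pi)⁻¹ * (√Real.pi)⁻¹ := by
    rw [← mul_inv, Real.mul_self_sqrt Real.pi_pos.le]
  rw [h1, h2, h3, h4, neg_add, Real.exp_add]
  simp
  ring

instance : IsProbabilityMeasure complexGaussian :=
  Measure.isProbabilityMeasure_map Complex.measurableEquivRealProd.symm.measurable.aemeasurable

instance (LR LT : ℕ) : IsProbabilityMeasure (channelLaw LR LT) := by
  unfold channelLaw; infer_instance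

instance (N LR LT : ℕ) : IsProbabilityMeasure (systemLaw N LR LT) := by
  unfold systemLaw; infer_instance

/-- The radial profile of the density of a standard complex Gaussian matrix. -/
def channelProfile (LR LT : ℕ) (t : ℝ) : ℝ≥0∞ :=
  ENNReal.ofReal ((Real.pi⁻¹ ^ LT) ^ LR * Real.exp (-t))

lemma measurable_channelProfile (LR LT : ℕ) : Measurable (channelProfile LR LT) := by
  unfold channelProfile
  fun_prop

/-- The exponents of the entry densities add up to the squared Frobenius norm, so the joint density
is radial; this is what makes polar coordinates useful. -/
lemma channelLaw_eq_withDensity (LR LT : ℕ) :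
    channelLaw LR LT = volume.withDensity fun A => channelProfile LR LT (frobSq A) := by
  unfold channelLaw
  have h0 : IsProbabilityMeasure (volume.withDensity complexGaussianDensity) := by
    rw [← complexGaussian_eq_withDensity]; infer_instance
  have h1 : (Measure.pi fun _ : Fin LT => complexGaussian) =
      volume.withDensity fun x => ∏ i, complexGaussianDensity (x i) := by
    simp_rw [complexGaussian_eq_withDensity]
    rw [pi_withDensity_fin _ measurable_complexGaussianDensity]
    rfl
  have h2 : IsProbabilityMeasure ((volume : Measure (Fin LT → ℂ)).withDensity
      fun x => ∏ i, complexGaussianDensity (x i)) := by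
    rw [← h1]; infer_instance
  rw [h1, pi_withDensity_fin _ (f := fun x : Fin LT → ℂ => ∏ i, complexGaussianDensity (x i))
    (Finset.measurable_prod _ fun i _ =>
    measurable_complexGaussianDensity.comp (measurable_pi_apply i))]
  change (volume : Measure (Channel LR LT)).withDensity _ = _
  congr 1
  funext A
  simp only [complexGaussianDensity, channelProfile, frobSq]
  have h3 : ∀ x : Fin LT → ℂ, ∏ i, ENNReal.ofReal (Real.pi⁻¹ * Real.exp (-‖x i‖ ^ 2)) =
      ENNReal.ofReal (∏ i, Real.pi⁻¹ * Real.exp (-‖x i‖ ^ 2)) := fun x =>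
    (ENNReal.ofReal_prod_of_nonneg fun i _ => by positivity).symm
  simp_rw [h3]
  rw [← ENNReal.ofReal_prod_of_nonneg fun i _ => by positivity]
  simp [Finset.prod_mul_distrib, ← Real.exp_sum]

lemma channelLaw_absolutelyContinuous (LR LT : ℕ) : channelLaw LR LT ≪ volume := by
  rw [channelLaw_eq_withDensity]
  exact withDensity_absolutelyContinuous _ _

/-- Guarantees that the shells around unit trace, which are open and nonempty, have positive
probability. -/
lemma volume_absolutelyContinuous_channelLaw (LR LT : ℕ) : volume ≪ channelLaw LR LT := by
  rw [channelLaw_eq_withDensity]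
  refine withDensity_absolutelyContinuous'
    ((measurable_channelProfile LR LT).comp continuous_frobSq.measurable).aemeasurable ?_
  refine Eventually.of_forall fun A => ?_
  have := Real.pi_pos
  simp only [channelProfile, ne_eq, ENNReal.ofReal_eq_zero, not_le]
  positivity

/-! ### Polar coordinates and functions homogeneous of degree two. -/

section Polar

variable {E : Type*} [NormedAddCommGroup E] [NormedSpace ℝ E] [FiniteDimensional ℝ E]
  [Nontrivial E] [MeasurableSpace E] [BorelSpace E] (μ : Measure E) [μ.IsAddHaarMeasure]

/-- Since f(rθ) = r² f(θ), the polar integral factors into a spherical part, which alone involves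
`f`, and a radial part, which alone involves `g`. -/
lemma lintegral_homogeneous_mul_norm {f : E → ℝ≥0∞} (hf : Measurable f)
    (hom : ∀ r : ℝ, 0 < r → ∀ x, f (r • x) = ENNReal.ofReal (r ^ 2) * f x)
    {g : ℝ → ℝ≥0∞} (hg : Measurable g) :
    ∫⁻ x, f x * g ‖x‖ ∂μ = (∫⁻ θ, f θ.1 ∂μ.toSphere) *
      ∫⁻ r : Set.Ioi (0 : ℝ), ENNReal.ofReal (r.1 ^ 2) * g r.1
        ∂(Measure.volumeIoiPow (Module.finrank ℝ E - 1)) := by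
  rw [← lintegral_prod_mul (by fun_prop) (by fun_prop),
    ← μ.measurePreserving_homeomorphUnitSphereProd.lintegral_comp (by fun_prop)]
  -- The origin has no polar coordinates, but it is a null set.
  conv_lhs => rw [← restrict_compl_singleton (μ := μ) 0,
    ← lintegral_subtype_comap (measurableSet_singleton _).compl]
  refine lintegral_congr fun x => ?_
  have hx : 0 < ‖x.1‖ := norm_pos_iff.2 x.2
  simp only [homeomorphUnitSphereProd_apply_snd_coe, homeomorphUnitSphereProd_apply_fst_coe]
  rw [← mul_assoc, mul_comm (f (_ • _)), ← hom _ hx, smul_smul, mul_inv_cancel₀ hx.ne', one_smul]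

/-- The integral of a function that is homogeneous of degree two against a radial density is
proportional to that of the squared norm. -/
lemma exists_lintegral_homogeneous_mul_norm_eq {f : E → ℝ≥0∞} (hf : Measurable f)
    (hom : ∀ r : ℝ, 0 < r → ∀ x, f (r • x) = ENNReal.ofReal (r ^ 2) * f x)
    (hle : ∀ x, f x ≤ ENNReal.ofReal (‖x‖ ^ 2)) :
    ∃ C : ℝ≥0∞, C ≠ ∞ ∧ ∀ g : ℝ → ℝ≥0∞, Measurable g →
      ∫⁻ x, f x * g ‖x‖ ∂μ = C * ∫⁻ x, ENNReal.ofReal (‖x‖ ^ 2) * g ‖x‖ ∂μ := by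
  have h1 : ∫⁻ θ : Metric.sphere (0 : E) 1, ENNReal.ofReal (‖θ.1‖ ^ 2) ∂μ.toSphere =
      μ.toSphere Set.univ := by simp
  have h0 : μ.toSphere Set.univ ≠ 0 := 
    Measure.measure_univ_ne_zero.2 μ.toSphere_ne_zero
  have ht : μ.toSphere Set.univ ≠ ∞ := measure_ne_top _ _
  -- The constant is the mean of `f` over the unit sphere; it does not involve `g`.
  refine ⟨(∫⁻ θ, f θ.1 ∂μ.toSphere) / μ.toSphere Set.univ, ?_, fun g hg => ?_⟩
  · refine ENNReal.div_ne_top (ne_top_of_le_ne_top ht ?_) h0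
    rw [← h1]
    exact lintegral_mono fun θ => hle θ.1
  · rw [lintegral_homogeneous_mul_norm μ hf hom hg,
      lintegral_homogeneous_mul_norm μ (f := fun x => ENNReal.ofReal (‖x‖ ^ 2)) (by fun_prop) ?_ hg,
      h1, ← mul_assoc, ENNReal.div_mul_cancel h0 ht]
    intro r hr x
    rw [norm_smul, mul_pow, Real.norm_eq_abs, sq_abs, ENNReal.ofReal_mul (sq_nonneg _)]

end Polar

/-! ### The top eigenvalue is on average `zetaOne` times the squared norm. -/

/-- Matrices with the Frobenius norm, as a Euclidean space. -/
def channelEquiv (LR LT : ℕ) : EuclideanSpace ℂ (Fin LR × Fin LT) ≃L[ℝ] Channel LR LT :=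
  LinearEquiv.toContinuousLinearEquiv
    { toFun := fun x i j => x (i, j)
      invFun := fun A => WithLp.toLp 2 fun p => A p.1 p.2
      map_add' := fun _ _ => rfl
      map_smul' := fun _ _ => rfl
      left_inv := fun _ => rfl
      right_inv := fun _ => rfl }

lemma frobSq_channelEquiv {LR LT : ℕ} (x : EuclideanSpace ℂ (Fin LR × Fin LT)) :
    frobSq (channelEquiv LR LT x) = ‖x‖ ^ 2 := by
  rw [EuclideanSpace.norm_sq_eq, Fintype.sum_prod_type]
  rfl

/-- `Channel` carries the sup norm, whereas polar coordinates need the Frobenius norm. Pulling the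
volume back to the Euclidean model gives some Haar measure, whose normalization is irrelevant. -/
lemma exists_addHaar_measurePreserving_channelEquiv (LR LT : ℕ) :
    ∃ μ : Measure (EuclideanSpace ℂ (Fin LR × Fin LT)), μ.IsAddHaarMeasure ∧
      MeasurePreserving (channelEquiv LR LT) μ volume := by
  let T := channelEquiv LR LT
  have hw : (volume : Measure (Fin LT → ℂ)).IsAddHaarMeasure := inferInstance
  have hv : (volume : Measure (Channel LR LT)).IsAddHaarMeasure :=
    Measure.pi.isAddHaarMeasure fun _ : Fin LR => (volume : Measure (Fin LT → ℂ))
  refine ⟨(volume : Measure (Channel LR LT)).map T.symm, T.symm.isAddHaarMeasure_map volume,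
    T.continuous.measurable, ?_⟩
  rw [Measure.map_map T.continuous.measurable T.symm.continuous.measurable]
  simp [T]

lemma nontrivial_channelSpace {LR LT : ℕ} (hLR : 1 ≤ LR) (hLT : 1 ≤ LT) :
    Nontrivial (EuclideanSpace ℂ (Fin LR × Fin LT)) := by
  have : Nonempty (Fin LR × Fin LT) := ⟨⟨0, hLR⟩, ⟨0, hLT⟩⟩
  infer_instance

lemma exists_lintegral_topEigenvalue_mul_eq {LR LT : ℕ} (hLR : 1 ≤ LR) (hLT : 1 ≤ LT) :
    ∃ C : ℝ≥0∞, C ≠ ∞ ∧ ∀ g : ℝ → ℝ≥0∞, Measurable g →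
      ∫⁻ A, ENNReal.ofReal (topEigenvalue A) * g (frobSq A) ∂(channelLaw LR LT) =
        C * ∫⁻ A, ENNReal.ofReal (frobSq A) * g (frobSq A) ∂(channelLaw LR LT) := by
  have := nontrivial_channelSpace hLR hLT
  obtain ⟨μ, hμ, hT⟩ := exists_addHaar_measurePreserving_channelEquiv LR LT
  set T := channelEquiv LR LT
  have hm := continuous_topEigenvalue (LR := LR) (LT := LT) |>.measurable
  have hmf := continuous_frobSq (LR := LR) (LT := LT) |>.measurable
  have hTm : Measurable T := hT.measurable
  obtain ⟨C, hC, h⟩ := exists_lintegral_homogeneous_mul_norm_eq μ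
    (f := fun x => ENNReal.ofReal (topEigenvalue (T x))) (by fun_prop)
    (fun r hr x => by rw [map_smul, topEigenvalue_smul, ENNReal.ofReal_mul (sq_nonneg _)])
    (fun x => by
      rw [← frobSq_channelEquiv]
      exact ENNReal.ofReal_le_ofReal (topEigenvalue_le_frobSq _))
  refine ⟨C, hC, fun g hg => ?_⟩
  have hp := measurable_channelProfile LR LT
  rw [channelLaw_eq_withDensity, lintegral_withDensity_eq_lintegral_mul _ (by fun_prop)
    (by fun_prop), lintegral_withDensity_eq_lintegral_mul _ (by fun_prop) (by fun_prop),
    ← hT.lintegral_comp (by fun_prop), ← hT.lintegral_comp (by fun_prop)]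
  -- The Gaussian profile is absorbed into the radial weight; the squares turn the norm into
  -- `frobSq`.
  have := h (fun t => channelProfile LR LT (t ^ 2) * g (t ^ 2)) (by fun_prop)
  simp only [← frobSq_channelEquiv] at this
  simp only [Pi.mul_apply]
  convert this using 3
  all_goals exact mul_left_comm _ _ _

lemma integrable_normSq_complexGaussian : Integrable (fun z => ‖z‖ ^ 2) complexGaussian := by
  unfold complexGaussian
  rw [integrable_map_equiv]
  have h : MemLp (id : ℝ → ℝ) 2 (gaussianReal 0 (1 / 2)) := memLp_id_gaussianReal 2
  have h1 : Integrable (fun x : ℝ => x ^ 2) (gaussianReal 0 (1 / 2)) := h.integrable_sq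
  refine ((h1.comp_fst (gaussianReal 0 (1 / 2))).add
    (h1.comp_snd (gaussianReal 0 (1 / 2)))).congr (Eventually.of_forall fun z => ?_)
  simp only [Function.comp, Pi.add_apply]
  rw [← Complex.normSq_eq_norm_sq, Complex.normSq_apply]
  simp [Complex.measurableEquivRealProd, sq]

lemma integrable_frobSq (LR LT : ℕ) : Integrable frobSq (channelLaw LR LT) := by
  unfold frobSq
  refine integrable_finsetSum _ fun i _ => integrable_finsetSum _ fun j _ => ?_
  have h1 : MeasurePreserving (fun A : Channel LR LT => A i j) (channelLaw LR LT) complexGaussian :=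
    (measurePreserving_eval (fun _ : Fin LT => complexGaussian) j).comp
      (measurePreserving_eval (fun _ : Fin LR => Measure.pi fun _ : Fin LT => complexGaussian) i)
  exact h1.integrable_comp_of_integrable integrable_normSq_complexGaussian

lemma integrable_topEigenvalue (LR LT : ℕ) : Integrable topEigenvalue (channelLaw LR LT) := by
  refine (integrable_frobSq LR LT).mono' continuous_topEigenvalue.aestronglyMeasurable
    (Eventually.of_forall fun A => ?_)
  rw [Real.norm_of_nonneg (topEigenvalue_nonneg A)]
  exact topEigenvalue_le_frobSq A

/-- A level set of the squared norm lies in a sphere, which is Haar null. This rules out ties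
between users. -/
lemma channelLaw_frobSq_eq_null {LR LT : ℕ} (hLR : 1 ≤ LR) (hLT : 1 ≤ LT) (t : ℝ) :
    channelLaw LR LT {A | frobSq A = t} = 0 := by
  have := nontrivial_channelSpace hLR hLT
  obtain ⟨μ, hμ, hT⟩ := exists_addHaar_measurePreserving_channelEquiv LR LT
  refine channelLaw_absolutelyContinuous LR LT ?_
  rw [← hT.measure_preimage
    (measurableSet_eq_fun continuous_frobSq.measurable measurable_const).nullMeasurableSet]
  refine measure_mono_null (fun x hx => ?_) (Measure.addHaar_sphere μ 0 (√t))
  have h : ‖x‖ ^ 2 = t := by rw [← frobSq_channelEquiv]; exact hx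
  simp [← h]

/-- The largest eigenvalue is proportional to the squared Frobenius norm on the average over every
set of matrices that is described by the norm. -/
lemma setIntegral_topEigenvalue_eq {LR LT : ℕ} {C : ℝ≥0∞}
    (h : ∀ g : ℝ → ℝ≥0∞, Measurable g →
      ∫⁻ A, ENNReal.ofReal (topEigenvalue A) * g (frobSq A) ∂(channelLaw LR LT) =
        C * ∫⁻ A, ENNReal.ofReal (frobSq A) * g (frobSq A) ∂(channelLaw LR LT))
    {S : Set ℝ} (hS : MeasurableSet S) :
    ∫ A in frobSq ⁻¹' S, topEigenvalue A ∂(channelLaw LR LT) =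
      C.toReal * ∫ A in frobSq ⁻¹' S, frobSq A ∂(channelLaw LR LT) := by
  have hS' : MeasurableSet (frobSq (LR := LR) (LT := LT) ⁻¹' S) :=
    continuous_frobSq.measurable hS
  rw [integral_eq_lintegral_of_nonneg_ae (Eventually.of_forall topEigenvalue_nonneg)
      continuous_topEigenvalue.aestronglyMeasurable,
    integral_eq_lintegral_of_nonneg_ae (Eventually.of_forall frobSq_nonneg)
      continuous_frobSq.aestronglyMeasurable, ← ENNReal.toReal_mul]
  have := h (S.indicator 1) (measurable_one.indicator hS)
  have key : ∀ f : Channel LR LT → ℝ≥0∞,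
      ∫⁻ A, f A * S.indicator 1 (frobSq A) ∂(channelLaw LR LT) =
        ∫⁻ A in frobSq ⁻¹' S, f A ∂(channelLaw LR LT) := by
    intro f
    rw [← lintegral_indicator hS']
    refine lintegral_congr fun A => ?_
    by_cases hA : frobSq A ∈ S <;> simp [Set.indicator, hA]
  rw [key, key] at this
  rw [this]

/-- The average of the largest eigenvalue over the matrices of squared Frobenius norm near one. -/
lemma tendsto_average_topEigenvalue {LR LT : ℕ} (hLR : 1 ≤ LR) (hLT : 1 ≤ LT) {C : ℝ≥0∞}
    (h : ∀ g : ℝ → ℝ≥0∞, Measurable g →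
      ∫⁻ A, ENNReal.ofReal (topEigenvalue A) * g (frobSq A) ∂(channelLaw LR LT) =
        C * ∫⁻ A, ENNReal.ofReal (frobSq A) * g (frobSq A) ∂(channelLaw LR LT)) :
    Tendsto (fun ε : ℝ => ⨍ A in {A : Channel LR LT | |wishartTrace A - 1| < ε},
      topEigenvalue A ∂(channelLaw LR LT)) (𝓝[>] 0) (𝓝 C.toReal) := by
  rw [tendsto_iff_norm_sub_tendsto_zero]
  have hlim : Tendsto (fun ε : ℝ => C.toReal * ε) (𝓝[>] 0) (𝓝 0) := by
    have : Tendsto (fun ε : ℝ => C.toReal * ε) (𝓝 0) (𝓝 (C.toReal * 0)) :=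
      tendsto_id.const_mul _
    rw [mul_zero] at this
    exact this.mono_left nhdsWithin_le_nhds
  refine squeeze_zero' (Eventually.of_forall fun _ => norm_nonneg _) ?_ hlim
  filter_upwards [self_mem_nhdsWithin] with ε hε
  have hε : 0 < ε := hε
  set S : Set ℝ := {t | |t - 1| < ε}
  have hSo : IsOpen S := isOpen_lt (by fun_prop) continuous_const
  have hset : {A : Channel LR LT | |wishartTrace A - 1| < ε} = frobSq ⁻¹' S := by
    ext A; simp [wishartTrace_eq_frobSq, S]
  rw [hset]
  set s : Set (Channel LR LT) := frobSq ⁻¹' S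
  have hso : IsOpen s := hSo.preimage continuous_frobSq
  have hne : s.Nonempty := by
    -- A single entry equal to one gives squared norm exactly one.
    refine ⟨Pi.single ⟨0, hLR⟩ (Pi.single ⟨0, hLT⟩ 1), ?_⟩
    have : frobSq (LR := LR) (LT := LT) (Pi.single ⟨0, hLR⟩ (Pi.single ⟨0, hLT⟩ 1)) = 1 := by
      unfold frobSq
      rw [Finset.sum_eq_single ⟨0, hLR⟩ (fun i _ hi => by simp [Pi.single_eq_of_ne hi]) (by simp),
        Finset.sum_eq_single ⟨0, hLT⟩ (fun i _ hi => by simp [Pi.single_eq_of_ne hi]) (by simp)]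
      simp
    simpa [s, S, this] using hε
  have hpos : 0 < (channelLaw LR LT).real s := by
    refine ENNReal.toReal_pos (fun h0 => ?_) (measure_ne_top _ _)
    have hw : (volume : Measure (Fin LT → ℂ)).IsOpenPosMeasure := inferInstance
    have hv : (volume : Measure (Channel LR LT)).IsOpenPosMeasure :=
      Measure.pi.isOpenPosMeasure fun _ : Fin LR => (volume : Measure (Fin LT → ℂ))
    exact hso.measure_ne_zero volume hne (volume_absolutelyContinuous_channelLaw LR LT h0)
  -- On the shell the squared norm is within `ε` of one, hence so is its average; multiplying by `C`
  -- bounds the error by `C ε`.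
  have hint : |∫ A in s, (frobSq A - 1) ∂(channelLaw LR LT)| ≤ ε * (channelLaw LR LT).real s := by
    rw [← Real.norm_eq_abs]
    exact norm_setIntegral_le_of_norm_le_const (measure_lt_top _ _) fun A hA => le_of_lt hA
  rw [integral_sub (integrable_frobSq LR LT).integrableOn (integrable_const _)] at hint
  simp only [integral_const, smul_eq_mul, mul_one, measureReal_restrict_apply_univ] at hint
  rw [setAverage_eq, setIntegral_topEigenvalue_eq h hSo.measurableSet, smul_eq_mul]
  have e : ((channelLaw LR LT).real s)⁻¹ * (C.toReal * ∫ A in s, frobSq A ∂(channelLaw LR LT)) -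
      C.toReal = C.toReal * ((∫ A in s, frobSq A ∂(channelLaw LR LT) -
        (channelLaw LR LT).real s) / (channelLaw LR LT).real s) := by
    field_simp
  rw [e, norm_mul, Real.norm_of_nonneg ENNReal.toReal_nonneg, Real.norm_eq_abs, abs_div,
    abs_of_pos hpos]
  gcongr
  rwa [div_le_iff₀ hpos]

/-- The largest eigenvalue is `zetaOne` times the squared Frobenius norm, on the average against
every function of the norm. -/
lemma tendsto_zetaOne_and_lintegral {LR LT : ℕ} (hLR : 1 ≤ LR) (hLT : 1 ≤ LT) :
    Tendsto (fun ε : ℝ => ⨍ A in {A : Channel LR LT | |wishartTrace A - 1| < ε},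
      topEigenvalue A ∂(channelLaw LR LT)) (𝓝[>] 0) (𝓝 (zetaOne LR LT)) ∧ 0 ≤ zetaOne LR LT ∧
    ∀ g : ℝ → ℝ≥0∞, Measurable g →
      ∫⁻ A, ENNReal.ofReal (topEigenvalue A) * g (frobSq A) ∂(channelLaw LR LT) =
        ENNReal.ofReal (zetaOne LR LT) *
          ∫⁻ A, ENNReal.ofReal (frobSq A) * g (frobSq A) ∂(channelLaw LR LT) := by
  obtain ⟨C, hC, h⟩ := exists_lintegral_topEigenvalue_mul_eq hLR hLT
  have ht := tendsto_average_topEigenvalue hLR hLT h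
  have hz : zetaOne LR LT = C.toReal := ht.limUnder_eq
  rw [hz, ENNReal.ofReal_toReal hC]
  exact ⟨ht, ENNReal.toReal_nonneg, h⟩

/-- The events generated by the trace are the preimages of Borel sets under `frobSq`, so
`setIntegral_topEigenvalue_eq` is the defining identity of the conditional expectation. -/
lemma condExp_topEigenvalue {LR LT : ℕ} (hLR : 1 ≤ LR) (hLT : 1 ≤ LT) :
    (channelLaw LR LT)[topEigenvalue (LR := LR) (LT := LT) |
        MeasurableSpace.comap (wishartTrace (LR := LR) (LT := LT)) inferInstance]
      =ᵐ[channelLaw LR LT] (fun A => zetaOne LR LT * wishartTrace A) := by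
  obtain ⟨-, h0, h⟩ := tendsto_zetaOne_and_lintegral hLR hLT
  have hw : wishartTrace (LR := LR) (LT := LT) = frobSq := funext wishartTrace_eq_frobSq
  rw [hw]
  have hm : MeasurableSpace.comap (frobSq (LR := LR) (LT := LT)) inferInstance ≤
      (inferInstance : MeasurableSpace (Channel LR LT)) := continuous_frobSq.measurable.comap_le
  refine (ae_eq_condExp_of_forall_setIntegral_eq hm (integrable_topEigenvalue LR LT)
    (fun _ _ _ => ((integrable_frobSq LR LT).const_mul _).integrableOn) ?_ ?_).symm
  · rintro _ ⟨S, hS, rfl⟩ -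
    rw [integral_const_mul, setIntegral_topEigenvalue_eq h hS, ENNReal.toReal_ofReal h0]
  · exact ((comap_measurable _).const_mul _).aestronglyMeasurable

/-! ### Selecting users by their norms. -/

section Pi

variable {ι : Type*} [Fintype ι] [DecidableEq ι] {X : ι → Type*} [∀ i, MeasurableSpace (X i)]
  (μ : ∀ i, Measure (X i)) [∀ i, SigmaFinite (μ i)]

/-- Fubini with all coordinates but the `i`-th frozen: it suffices to compare the slices. -/
lemma lintegral_pi_congr_of_slice (i : ι) {f g : (∀ i, X i) → ℝ≥0∞} (hf : Measurable f)
    (hg : Measurable g)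
    (h : ∀ x, ∫⁻ a, f (Function.update x i a) ∂μ i = ∫⁻ a, g (Function.update x i a) ∂μ i) :
    ∫⁻ x, f x ∂Measure.pi μ = ∫⁻ x, g x ∂Measure.pi μ := by
  refine lintegral_eq_of_lmarginal_eq {i} hf hg ?_
  rw [lmarginal_singleton, lmarginal_singleton]
  exact funext h

lemma measure_pi_eq_zero_of_slice (i : ι) {Z : Set (∀ i, X i)} (hZ : MeasurableSet Z)
    (h : ∀ x, μ i {a | Function.update x i a ∈ Z} = 0) : Measure.pi μ Z = 0 := by
  rw [← lintegral_indicator_one hZ]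
  refine (lintegral_pi_congr_of_slice μ i (measurable_one.indicator hZ) measurable_const
    (g := fun _ => 0) fun x => ?_).trans (by simp)
  have hm : MeasurableSet {a | Function.update x i a ∈ Z} := measurable_update x hZ
  have := lintegral_indicator_one (μ := μ i) hm
  rw [h x] at this
  rw [lintegral_zero, ← this]
  rfl

end Pi

/-- Independent values of a function whose law has no atoms are distinct. -/
lemma ae_injective_comp {ι α : Type*} [Fintype ι] [MeasurableSpace α] (μ : Measure α)
    [SigmaFinite μ] {f : α → ℝ} (hf : Measurable f) (h : ∀ t, μ {a | f a = t} = 0) :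
    ∀ᵐ x ∂(Measure.pi fun _ : ι => μ), Function.Injective fun i => f (x i) := by
  classical
  have h1 : ∀ i j : ι, i ≠ j → ∀ᵐ x ∂(Measure.pi fun _ : ι => μ), f (x i) ≠ f (x j) := by
    intro i j hij
    rw [ae_iff]
    simp only [ne_eq, not_not]
    refine measure_pi_eq_zero_of_slice (fun _ => μ) i
      (measurableSet_eq_fun (by fun_prop) (by fun_prop)) fun x => ?_
    simpa [Function.update_of_ne hij.symm] using h (f (x j))
  have h2 : ∀ᵐ x ∂(Measure.pi fun _ : ι => μ), ∀ i j : ι, i ≠ j → f (x i) ≠ f (x j) := by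
    rw [ae_all_iff]; intro i
    rw [ae_all_iff]; intro j
    by_cases hij : i = j
    · exact Eventually.of_forall fun _ h => absurd hij h
    · filter_upwards [h1 i j hij] with x hx _ using hx
  filter_upwards [h2] with x hx i j hij
  by_contra hne
  exact hx i j hne hij

/-- The number of entries that exceed the `i`-th one. -/
def rank {N : ℕ} (n : Fin N → ℝ) (i : Fin N) : ℕ := (Finset.univ.filter fun j => n i < n j).card

lemma rank_injective {N : ℕ} {n : Fin N → ℝ} (hn : Function.Injective n) :
    Function.Injective (rank n) := by
  have key : ∀ i j, n i < n j → rank n j < rank n i := by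
    intro i j hij
    refine Finset.card_lt_card (Finset.ssubset_iff_of_subset (fun l hl => ?_) |>.2 ⟨j, ?_, ?_⟩)
    · simp only [Finset.mem_filter, Finset.mem_univ, true_and] at hl ⊢
      exact hij.trans hl
    · simpa using hij
    · simp
  intro i j h
  by_contra hne
  rcases lt_or_gt_of_ne (hn.ne hne) with h1 | h1
  · exact (key i j h1).ne h.symm
  · exact (key j i h1).ne h

lemma measurable_rank {N : ℕ} (i : Fin N) : Measurable fun n : Fin N → ℝ => rank n i := by
  have : (fun n : Fin N → ℝ => rank n i) =
      fun n => ∑ j, Set.indicator {n : Fin N → ℝ | n i < n j} (fun _ => 1) n := by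
    funext n
    simp only [rank, Finset.card_filter, Set.indicator_apply, Set.mem_ofPred_eq]
  rw [this]
  exact Finset.measurable_sum _ fun j _ =>
    measurable_const.indicator (measurableSet_lt (measurable_pi_apply i) (measurable_pi_apply j))

/-- Without ties, the users that beat `σ k` are exactly `σ l` for `l < k`; both `rank` and `k` count
from zero. -/
lemma IsUserSelection.rank_eq {N s LR LT : ℕ} {H : Fin N → Channel LR LT} {σ : Fin s → Fin N}
    (hσ : IsUserSelection H σ) (hinj : Function.Injective fun i => frobSq (H i)) (k : Fin s) :
    rank (fun i => frobSq (H i)) (σ k) = k := by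
  have : (Finset.univ.filter fun j => frobSq (H (σ k)) < frobSq (H j)) =
      (Finset.Iio k).image σ := by
    ext j
    simp only [Finset.mem_filter, Finset.mem_univ, true_and, Finset.mem_image, Finset.mem_Iio]
    constructor
    · intro hj
      by_cases hr : j ∈ Set.range σ
      · obtain ⟨l, rfl⟩ := hr
        refine ⟨l, ?_, rfl⟩
        by_contra hl
        exact absurd (hσ.antitone (not_lt.1 hl)) (not_le.2 hj)
      · exact absurd (hσ.unselected_le j hr k) (not_le.2 hj)
    · rintro ⟨l, hl, rfl⟩
      refine lt_of_le_of_ne (hσ.antitone hl.le) fun h => ?_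
      exact hl.ne' (hσ.injective (hinj h))
  rw [rank, this, Finset.card_image_of_injective _ hσ.injective, Fin.card_Iio]

/-- Whatever the tie-breaking rule, the event that user `i` comes `k`-th is thus a function of the
norms alone, outside a null set. -/
lemma IsUserSelection.apply_eq_iff {N s LR LT : ℕ} {H : Fin N → Channel LR LT} {σ : Fin s → Fin N}
    (hσ : IsUserSelection H σ) (hinj : Function.Injective fun i => frobSq (H i)) (k : Fin s)
    (i : Fin N) : σ k = i ↔ rank (fun i => frobSq (H i)) i = k := by
  rw [← hσ.rank_eq hinj k]
  exact ⟨fun h => by rw [h], fun h => (rank_injective hinj h).symm⟩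

section Selection

variable {N s LR LT : ℕ} {sel : (Fin N → Channel LR LT) → Fin s → Fin N}

lemma measurable_selected (hm : Measurable sel) (k : Fin s) :
    Measurable fun H : Fin N → Channel LR LT => H (sel H k) := by
  have h1 : Measurable fun p : (Fin N → Channel LR LT) × Fin N => p.1 p.2 :=
    measurable_from_prod_countable_left fun i => measurable_pi_apply i
  exact h1.comp (measurable_id.prodMk ((measurable_pi_apply k).comp hm))

lemma integrable_comp_selected (hm : Measurable sel) {f : Channel LR LT → ℝ} (hf : Measurable f)
    (h0 : ∀ A, 0 ≤ f A) (hi : Integrable f (channelLaw LR LT)) (k : Fin s) :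
    Integrable (fun H => f (H (sel H k))) (systemLaw N LR LT) := by
  have h1 : Integrable (fun H : Fin N → Channel LR LT => ∑ i, f (H i)) (systemLaw N LR LT) :=
    integrable_finsetSum _ fun i _ =>
      (measurePreserving_eval (fun _ : Fin N => channelLaw LR LT) i).integrable_comp_of_integrable hi
  refine h1.mono' (hf.comp (measurable_selected hm k)).aestronglyMeasurable
    (Eventually.of_forall fun H => ?_)
  rw [Real.norm_of_nonneg (h0 _)]
  exact Finset.single_le_sum (f := fun i => f (H i)) (fun i _ => h0 _) (Finset.mem_univ (sel H k))

lemma lintegral_comp_selected (hLR : 1 ≤ LR) (hLT : 1 ≤ LT) (hsel : ∀ H, IsUserSelection H (sel H))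
    {f : Channel LR LT → ℝ≥0∞} (hf : Measurable f) (k : Fin s) :
    ∫⁻ H, f (H (sel H k)) ∂(systemLaw N LR LT) =
      ∑ i, ∫⁻ H, f (H i) * (if rank (fun j => frobSq (H j)) i = k then 1 else 0)
        ∂(systemLaw N LR LT) := by
  have hfr := continuous_frobSq (LR := LR) (LT := LT) |>.measurable
  have hr : ∀ i : Fin N, Measurable fun H : Fin N → Channel LR LT =>
      rank (fun j => frobSq (H j)) i := fun i => (measurable_rank i).comp
      (measurable_pi_lambda _ fun j => hfr.comp (measurable_pi_apply j))
  have hite : ∀ i : Fin N, Measurable fun H : Fin N → Channel LR LT =>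
      if rank (fun j => frobSq (H j)) i = k then (1 : ℝ≥0∞) else 0 := fun i =>
    Measurable.ite (hr i (measurableSet_singleton _)) measurable_const measurable_const
  rw [← lintegral_finsetSum _ fun i _ => by fun_prop]
  refine lintegral_congr_ae ?_
  filter_upwards [ae_injective_comp (ι := Fin N) (channelLaw LR LT) hfr
    (channelLaw_frobSq_eq_null hLR hLT)] with H hH
  rw [Finset.sum_eq_single (sel H k)]
  · rw [if_pos ((hsel H).rank_eq hH k), mul_one]
  · intro i _ hi
    rw [if_neg fun h => hi (((hsel H).apply_eq_iff hH k i).2 h).symm, mul_zero]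
  · simp

/-- The integral is split according to which user `i` is selected. With the other users frozen, the
indicator of this event is a function of the norm of the `i`-th matrix, so it may serve as the
radial weight that defines no new constant besides `zetaOne`. -/
lemma integral_topEigenvalue_selected (hLR : 1 ≤ LR) (hLT : 1 ≤ LT) (hm : Measurable sel)
    (hsel : ∀ H, IsUserSelection H (sel H)) (k : Fin s) :
    ∫ H, topEigenvalue (H (sel H k)) ∂(systemLaw N LR LT) =
      zetaOne LR LT * ∫ H, frobSq (H (sel H k)) ∂(systemLaw N LR LT) := by
  obtain ⟨-, h0, h⟩ := tendsto_zetaOne_and_lintegral hLR hLT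
  have hfr := continuous_frobSq (LR := LR) (LT := LT) |>.measurable
  have hte := continuous_topEigenvalue (LR := LR) (LT := LT) |>.measurable
  have hr : ∀ i : Fin N, Measurable fun H : Fin N → Channel LR LT =>
      rank (fun j => frobSq (H j)) i := fun i => (measurable_rank i).comp
      (measurable_pi_lambda _ fun j => hfr.comp (measurable_pi_apply j))
  rw [integral_eq_lintegral_of_nonneg_ae (Eventually.of_forall fun _ => topEigenvalue_nonneg _)
      (hte.comp (measurable_selected hm k)).aestronglyMeasurable,
    integral_eq_lintegral_of_nonneg_ae (Eventually.of_forall fun _ => frobSq_nonneg _)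
      (hfr.comp (measurable_selected hm k)).aestronglyMeasurable,
    lintegral_comp_selected hLR hLT hsel (f := fun A => ENNReal.ofReal (topEigenvalue A))
      (by fun_prop),
    lintegral_comp_selected hLR hLT hsel (f := fun A => ENNReal.ofReal (frobSq A)) (by fun_prop)]
  conv_rhs => rw [← ENNReal.toReal_ofReal h0, ← ENNReal.toReal_mul, Finset.mul_sum]
  congr 1
  refine Finset.sum_congr rfl fun i _ => ?_
  have hite : Measurable fun H : Fin N → Channel LR LT =>
      if rank (fun j => frobSq (H j)) i = k then (1 : ℝ≥0∞) else 0 :=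
    Measurable.ite (hr i (measurableSet_singleton _)) measurable_const measurable_const
  rw [← lintegral_const_mul _ (by fun_prop)]
  refine lintegral_pi_congr_of_slice (fun _ : Fin N => channelLaw LR LT) i (by fun_prop)
    (by fun_prop) fun H => ?_
  have hn : ∀ A : Channel LR LT, (fun j => frobSq (Function.update H i A j)) =
      Function.update (fun j => frobSq (H j)) i (frobSq A) := by
    intro A
    funext j
    by_cases hj : j = i
    · subst hj; simp
    · simp [Function.update_of_ne hj]
  simp only [Function.update_self, hn]
  have hg : Measurable fun t : ℝ =>
      if rank (Function.update (fun j => frobSq (H j)) i t) i = k then (1 : ℝ≥0∞) else 0 :=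
    Measurable.ite ((measurable_rank i).comp (measurable_update _) (measurableSet_singleton _))
      measurable_const measurable_const
  rw [h _ hg, lintegral_const_mul' _ _ ENNReal.ofReal_ne_top]

end Selection

/-! ### Unitary maps acting on the sphere. -/

section Rotation

variable {LT : ℕ}

lemma UnitVec.norm_eq (v : UnitVec LT) : ‖v.1‖ = 1 := by simp

/-- A unitary map, acting on unit vectors. -/
def rotate (U : EuclideanSpace ℂ (Fin LT) ≃ₗᵢ[ℂ] EuclideanSpace ℂ (Fin LT)) (b : UnitVec LT) :
    UnitVec LT :=
  ⟨U b.1, by simp⟩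

/-- The spherical measure of a set is a multiple of the volume of the cone over it; a unitary map
preserves volume and carries cones to cones. -/
lemma measurePreserving_rotate
    (U : EuclideanSpace ℂ (Fin LT) ≃ₗᵢ[ℂ] EuclideanSpace ℂ (Fin LT)) :
    MeasurePreserving (rotate U) (isotropicVec LT) (isotropicVec LT) := by
  have hc : Continuous (rotate U) := by unfold rotate; fun_prop
  let W : EuclideanSpace ℂ (Fin LT) ≃ₗᵢ[ℝ] EuclideanSpace ℂ (Fin LT) :=
    { U.toLinearEquiv.restrictScalars ℝ with norm_map' := U.norm_map }
  have hW := W.measurePreserving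
  have h : MeasurePreserving (rotate U)
      (volume : Measure (EuclideanSpace ℂ (Fin LT))).toSphere
      (volume : Measure (EuclideanSpace ℂ (Fin LT))).toSphere := by
    refine ⟨hc.measurable, Measure.ext fun t ht => ?_⟩
    rw [Measure.map_apply hc.measurable ht, Measure.toSphere_apply' _ (hc.measurable ht),
      Measure.toSphere_apply' _ ht,
      ← hW.measure_preimage_emb W.toHomeomorph.measurableEmbedding
        (Set.Ioo (0 : ℝ) 1 • (Subtype.val '' t))]
    congr 2
    ext x
    simp only [Set.mem_smul, Set.mem_image, Set.mem_preimage]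
    constructor
    · rintro ⟨r, hr, _, ⟨u, hu, rfl⟩, rfl⟩
      exact ⟨r, hr, _, ⟨rotate U u, hu, rfl⟩, (W.map_smul r u.1).symm⟩
    · rintro ⟨r, hr, _, ⟨u, hu, rfl⟩, hx⟩
      have hru : rotate U (rotate U.symm u) = u := Subtype.ext (U.apply_symm_apply u.1)
      refine ⟨r, hr, _, ⟨rotate U.symm u, by rwa [hru], rfl⟩, W.injective ?_⟩
      rw [← hx, W.map_smul]
      congr 1
      exact congrArg Subtype.val hru
  exact h.smul_measure _

instance [NeZero LT] : IsProbabilityMeasure (isotropicVec LT) where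
  measure_univ := by
    have : Nontrivial (EuclideanSpace ℂ (Fin LT)) := inferInstance
    unfold isotropicVec
    rw [Measure.smul_apply, smul_eq_mul, ENNReal.inv_mul_cancel
      (Measure.measure_univ_ne_zero.2 (Measure.toSphere_ne_zero _)) (measure_ne_top _ _)]

lemma exists_orthonormalBasis_apply_zero (hLT : 2 ≤ LT) (v : UnitVec LT) :
    ∃ b : OrthonormalBasis (Fin LT) ℂ (EuclideanSpace ℂ (Fin LT)), b ⟨0, by omega⟩ = v.1 := by
  have ho : Orthonormal ℂ (({⟨0, by omega⟩} : Set (Fin LT)).domRestrict fun _ => v.1) := by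
    refine ⟨fun i => v.norm_eq, fun i j hij => absurd ?_ hij⟩
    exact Subsingleton.elim i j
  obtain ⟨b, hb⟩ := ho.exists_orthonormalBasis_extension_of_card_eq (by simp)
  exact ⟨b, hb _ rfl⟩

lemma exists_orthonormalBasis_apply_zero_one (hLT : 2 ≤ LT) (v w : UnitVec LT)
    (h : inner ℂ v.1 w.1 = (0 : ℂ)) :
    ∃ b : OrthonormalBasis (Fin LT) ℂ (EuclideanSpace ℂ (Fin LT)),
      b ⟨0, by omega⟩ = v.1 ∧ b ⟨1, by omega⟩ = w.1 := by
  have h01 : (⟨1, by omega⟩ : Fin LT) ≠ ⟨0, by omega⟩ := by simp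
  have h' : inner ℂ w.1 v.1 = (0 : ℂ) := inner_eq_zero_symm.1 h
  have ho : Orthonormal ℂ (({⟨0, by omega⟩, ⟨1, by omega⟩} : Set (Fin LT)).domRestrict
      fun i => if i = ⟨0, by omega⟩ then v.1 else w.1) := by
    constructor
    · rintro ⟨i, rfl | rfl⟩ <;> simp
    · rintro ⟨i, rfl | rfl⟩ ⟨j, rfl | rfl⟩ hij
      · exact absurd rfl hij
      · simpa using h
      · simpa using h'
      · exact absurd rfl hij
  obtain ⟨b, hb⟩ := ho.exists_orthonormalBasis_extension_of_card_eq (by simp)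
  refine ⟨b, ?_, ?_⟩
  · rw [hb _ (Or.inl rfl), if_pos rfl]
  · rw [hb _ (Or.inr rfl), if_neg h01]

lemma exists_rotate_eq (hLT : 2 ≤ LT) (v w : UnitVec LT) :
    ∃ U : EuclideanSpace ℂ (Fin LT) ≃ₗᵢ[ℂ] EuclideanSpace ℂ (Fin LT), U v.1 = w.1 := by
  obtain ⟨b, hb⟩ := exists_orthonormalBasis_apply_zero hLT v
  obtain ⟨b', hb'⟩ := exists_orthonormalBasis_apply_zero hLT w
  refine ⟨b.equiv b' (Equiv.refl _), ?_⟩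
  rw [← hb, ← hb']
  simp

/-- Completing both pairs to orthonormal bases shows that the stabilizer of `v` acts transitively on
the unit vectors orthogonal to `v`. -/
lemma exists_rotate_fixing_eq (hLT : 2 ≤ LT) (v w w' : UnitVec LT)
    (hw : inner ℂ v.1 w.1 = (0 : ℂ)) (hw' : inner ℂ v.1 w'.1 = (0 : ℂ)) :
    ∃ U : EuclideanSpace ℂ (Fin LT) ≃ₗᵢ[ℂ] EuclideanSpace ℂ (Fin LT),
      U v.1 = v.1 ∧ U w.1 = w'.1 := by
  obtain ⟨b, hb, hb1⟩ := exists_orthonormalBasis_apply_zero_one hLT v w hw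
  obtain ⟨b', hb', hb1'⟩ := exists_orthonormalBasis_apply_zero_one hLT v w' hw'
  refine ⟨b.equiv b' (Equiv.refl _), ?_, ?_⟩
  · conv_lhs => rw [← hb]
    rw [← hb']
    simp
  · rw [← hb1, ← hb1']
    simp

end Rotation

/-! ### Ties between codewords have probability zero. -/

/-- The directions that have a given squared inner product with `v` form a null cone: along the
lines of a suitable direction its equation is a nonzero polynomial. -/
lemma volume_inner_sq_eq_null {LT : ℕ} (hLT : 2 ≤ LT) (v : UnitVec LT) (c : ℝ) :
    volume {x : EuclideanSpace ℂ (Fin LT) | ‖inner ℂ v.1 x‖ ^ 2 = c * ‖x‖ ^ 2} = 0 := by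
  -- A direction off the cone: orthogonal to `v` when `c = 1`, and `v` itself otherwise.
  obtain ⟨e, he⟩ : ∃ e : EuclideanSpace ℂ (Fin LT), ‖inner ℂ v.1 e‖ ^ 2 - c * ‖e‖ ^ 2 ≠ 0 := by
    by_cases hc : c = 1
    · obtain ⟨b, hb⟩ := exists_orthonormalBasis_apply_zero hLT v
      refine ⟨b ⟨1, by omega⟩, ?_⟩
      rw [← hb, b.inner_eq_zero (by simp)]
      simp [hc]
    · refine ⟨v.1, ?_⟩
      rw [inner_self_eq_norm_sq_to_K, v.norm_eq]
      simpa [sub_eq_zero] using fun h : (1 : ℝ) = c => hc h.symm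
  set q : EuclideanSpace ℂ (Fin LT) → ℝ := fun x => ‖inner ℂ v.1 x‖ ^ 2 - c * ‖x‖ ^ 2
  have hq : Continuous q := by fun_prop
  have hs : MeasurableSet {x | q x ≠ 0} := (measurableSet_eq_fun hq.measurable
    measurable_const).compl
  let L : ℝ →ₗ[ℝ] EuclideanSpace ℂ (Fin LT) := LinearMap.toSpanSingleton ℝ _ e
  -- By Fubini it suffices that each line parallel to `e` meets the cone in a null set.
  have key := ae_mem_of_ae_add_linearMap_mem L (volume : Measure ℝ)
    (volume : Measure (EuclideanSpace ℂ (Fin LT))) hs fun y => ?_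
  · rw [ae_iff] at key
    convert key using 3
    simp [q, sub_eq_zero]
  · rw [ae_iff]
    have hexp : ∀ t : ℝ, q (y + L t) = q e * t ^ 2 +
        2 * ((inner ℂ v.1 y * (starRingEnd ℂ) (inner ℂ v.1 e)).re - c * (inner ℂ y e : ℂ).re) * t
          + q y := by
      intro t
      have h1 : L t = (t : ℂ) • e := by
        simp [L, LinearMap.toSpanSingleton_apply]
      have h2 : ‖y + (t : ℂ) • e‖ ^ 2 = ‖y‖ ^ 2 + 2 * t * (inner ℂ y e : ℂ).re + t ^ 2 * ‖e‖ ^ 2 := by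
        rw [norm_add_sq (𝕜 := ℂ), inner_smul_right, norm_smul, mul_pow]
        simp
        ring
      have h3 : ‖inner ℂ v.1 (y + (t : ℂ) • e)‖ ^ 2 = ‖inner ℂ v.1 y‖ ^ 2 +
          2 * t * (inner ℂ v.1 y * (starRingEnd ℂ) (inner ℂ v.1 e)).re +
            t ^ 2 * ‖inner ℂ v.1 e‖ ^ 2 := by
        rw [inner_add_right, inner_smul_right, ← Complex.normSq_eq_norm_sq,
          ← Complex.normSq_eq_norm_sq, ← Complex.normSq_eq_norm_sq, Complex.normSq_add]
        simp
        ring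
      simp only [q, h1, h2, h3]
      ring
    let p : Polynomial ℝ := Polynomial.C (q e) * Polynomial.X ^ 2 + Polynomial.C
      (2 * ((inner ℂ v.1 y * (starRingEnd ℂ) (inner ℂ v.1 e)).re - c * (inner ℂ y e : ℂ).re)) *
        Polynomial.X + Polynomial.C (q y)
    -- The leading coefficient is `q e`, so the line meets the cone in finitely many points.
    have hp : p ≠ 0 := fun h => he (by simpa [p] using congrArg (fun p => p.coeff 2) h)
    refine (Polynomial.finite_setOfPred_isRoot hp).subset (fun t ht => ?_) |>.measure_zero _
    simp only [Set.mem_ofPred_eq, ne_eq, not_not, hexp] at ht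
    simpa [p, Polynomial.IsRoot] using ht

lemma isotropicVec_inner_sq_eq_null {LT : ℕ} (hLT : 2 ≤ LT) (v : UnitVec LT) (c : ℝ) :
    isotropicVec LT {u | ‖inner ℂ v.1 u.1‖ ^ 2 = c} = 0 := by
  have hm : MeasurableSet {u : UnitVec LT | ‖inner ℂ v.1 u.1‖ ^ 2 = c} :=
    measurableSet_eq_fun (Continuous.measurable (by fun_prop)) measurable_const
  unfold isotropicVec
  rw [Measure.smul_apply, Measure.toSphere_apply' _ hm]
  refine (congrArg _ (mul_eq_zero_of_right _ (measure_mono_null ?_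
    (volume_inner_sq_eq_null hLT v c)))).trans (smul_zero _)
  rintro _ ⟨r, hr, _, ⟨u, hu, rfl⟩, rfl⟩
  have hu : ‖inner ℂ v.1 u.1‖ ^ 2 = c := hu
  change ‖inner ℂ v.1 (r • u.1)‖ ^ 2 = c * ‖r • u.1‖ ^ 2
  have h1 : r • u.1 = (r : ℂ) • u.1 := by simp
  rw [h1, inner_smul_right, norm_mul, norm_smul, mul_pow, mul_pow, hu, UnitVec.norm_eq u]
  ring

lemma continuous_gain {LT s : ℕ} (V : CompositeMatrix LT s) : Continuous (gain V) := by
  unfold gain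
  fun_prop

/-- With all columns but the zeroth frozen, the gain is a constant plus one squared inner product,
whose law has no atoms. -/
lemma isotropicComposite_gain_eq_null {LT s : ℕ} [NeZero LT] (hLT : 2 ≤ LT) (hs : 1 ≤ s)
    (V : CompositeMatrix LT s) (t : ℝ) : isotropicComposite LT s {b | gain V b = t} = 0 := by
  refine measure_pi_eq_zero_of_slice _ ⟨0, hs⟩
    (measurableSet_eq_fun (continuous_gain V).measurable measurable_const) fun b => ?_
  rw [← isotropicVec_inner_sq_eq_null hLT (V ⟨0, hs⟩)
    (t - ∑ k ∈ Finset.univ.erase ⟨0, hs⟩, ‖inner ℂ (V k).1 (b k).1‖ ^ 2)]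
  congr 1
  ext a
  simp only [Set.mem_ofPred_eq, gain]
  rw [← Finset.add_sum_erase _ _ (Finset.mem_univ (⟨0, hs⟩ : Fin s)), Function.update_self,
    eq_sub_iff_add_eq]
  have : ∑ k ∈ Finset.univ.erase (⟨0, hs⟩ : Fin s),
      ‖inner ℂ (V k).1 (Function.update b ⟨0, hs⟩ a k).1‖ ^ 2 =
      ∑ k ∈ Finset.univ.erase (⟨0, hs⟩ : Fin s), ‖inner ℂ (V k).1 (b k).1‖ ^ 2 :=
    Finset.sum_congr rfl fun k hk => by rw [Function.update_of_ne (Finset.ne_of_mem_erase hk)]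
  rw [this]

instance {LT s : ℕ} [NeZero LT] : IsProbabilityMeasure (isotropicComposite LT s) := by
  unfold isotropicComposite; infer_instance

instance {LT s K : ℕ} [NeZero LT] : IsProbabilityMeasure (codebookLaw LT s K) := by
  unfold codebookLaw; infer_instance

/-- Almost surely no two codewords have the same gain. -/
lemma ae_injective_gain {LT s K : ℕ} [NeZero LT] (hLT : 2 ≤ LT) (hs : 1 ≤ s)
    (V : CompositeMatrix LT s) :
    ∀ᵐ B ∂(codebookLaw LT s K), Function.Injective fun j => gain V (B j) :=
  ae_injective_comp (isotropicComposite LT s) (continuous_gain V).measurable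
    (isotropicComposite_gain_eq_null hLT hs V)

/-! ### Second moments invariant under the stabilizer of a vector. -/

section SecondMoment

variable {LT : ℕ} {Ω : Type*} [MeasurableSpace Ω] (μ : Measure Ω) (X : Ω → UnitVec LT)

/-- The expectation of `|h† X|²` for a random unit vector `X`. -/
def secondMoment (h : EuclideanSpace ℂ (Fin LT)) : ℝ := ∫ ω, ‖inner ℂ h (X ω).1‖ ^ 2 ∂μ

variable {μ X}

lemma integrable_inner_sq [IsFiniteMeasure μ] (hX : Measurable X)
    (h : EuclideanSpace ℂ (Fin LT)) : Integrable (fun ω => ‖inner ℂ h (X ω).1‖ ^ 2) μ := by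
  have hc : Continuous fun u : UnitVec LT => ‖inner ℂ h u.1‖ ^ 2 := by fun_prop
  refine Integrable.of_bound (hc.measurable.comp hX).aestronglyMeasurable (‖h‖ ^ 2)
    (Eventually.of_forall fun ω => ?_)
  rw [Real.norm_of_nonneg (sq_nonneg _)]
  have := norm_inner_le_norm (𝕜 := ℂ) h (X ω).1
  rw [(X ω).norm_eq, mul_one] at this
  gcongr

lemma secondMoment_smul (z : ℂ) (h : EuclideanSpace ℂ (Fin LT)) :
    secondMoment μ X (z • h) = ‖z‖ ^ 2 * secondMoment μ X h := by
  simp only [secondMoment, inner_smul_left, norm_mul, mul_pow, RCLike.norm_conj]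
  rw [integral_const_mul]

lemma secondMoment_add_add_sub [IsFiniteMeasure μ] (hX : Measurable X)
    (x y : EuclideanSpace ℂ (Fin LT)) :
    secondMoment μ X (x + y) + secondMoment μ X (x - y) =
      2 * (secondMoment μ X x + secondMoment μ X y) := by
  unfold secondMoment
  rw [← integral_add (integrable_inner_sq hX _) (integrable_inner_sq hX _),
    ← integral_add (integrable_inner_sq hX _) (integrable_inner_sq hX _), ← integral_const_mul]
  refine integral_congr_ae (Eventually.of_forall fun ω => ?_)
  have := parallelogram_law_with_norm ℝ (inner ℂ x (X ω).1) (inner ℂ y (X ω).1)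
  simp only [inner_add_left, inner_sub_left]
  simpa only [sq] using this

/-- Parseval for the unit vector `X`: the second-moment form has trace one. -/
lemma sum_secondMoment [IsProbabilityMeasure μ] (hX : Measurable X)
    (b : OrthonormalBasis (Fin LT) ℂ (EuclideanSpace ℂ (Fin LT))) :
    ∑ i, secondMoment μ X (b i) = 1 := by
  unfold secondMoment
  rw [← integral_finsetSum _ fun i _ => integrable_inner_sq hX _]
  simp_rw [b.sum_sq_norm_inner_right]
  simp

/-- The second moment of a random unit vector whose law is invariant under the unitary maps that
fix `v`. -/
lemma secondMoment_eq_of_invariant [IsProbabilityMeasure μ] (hLT : 2 ≤ LT) (hX : Measurable X)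
    (v : UnitVec LT)
    (hinv : ∀ U : EuclideanSpace ℂ (Fin LT) ≃ₗᵢ[ℂ] EuclideanSpace ℂ (Fin LT), U v.1 = v.1 →
      ∀ h, secondMoment μ X (U h) = secondMoment μ X h) (h : EuclideanSpace ℂ (Fin LT)) :
    secondMoment μ X h = secondMoment μ X v.1 * ‖inner ℂ v.1 h‖ ^ 2 +
      (1 - secondMoment μ X v.1) / (LT - 1) * (‖h‖ ^ 2 - ‖inner ℂ v.1 h‖ ^ 2) := by
  set f := secondMoment μ X
  obtain ⟨b, hb⟩ := exists_orthonormalBasis_apply_zero hLT v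
  have hvv : inner ℂ v.1 v.1 = (1 : ℂ) := by
    rw [inner_self_eq_norm_sq_to_K, v.norm_eq]; simp
  set c := (1 - f v.1) / ((LT : ℝ) - 1) with hc
  have hLT' : (LT : ℝ) - 1 ≠ 0 := by
    have : (2 : ℝ) ≤ LT := by exact_mod_cast hLT
    linarith
  have hunit : ∀ w w' : UnitVec LT, inner ℂ v.1 w.1 = (0 : ℂ) → inner ℂ v.1 w'.1 = (0 : ℂ) →
      f w.1 = f w'.1 := by
    intro w w' hw hw'
    obtain ⟨U, hU, hUw⟩ := exists_rotate_fixing_eq hLT v w w' hw hw'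
    rw [← hUw, hinv U hU]
  -- The trace is the value at `v` plus `LT - 1` equal values on the complement, which determines
  -- `c`.
  have hperp1 : ∀ w : UnitVec LT, inner ℂ v.1 w.1 = (0 : ℂ) → f w.1 = c := by
    intro w hw
    have hsum := sum_secondMoment (μ := μ) hX b
    rw [← Finset.add_sum_erase _ _ (Finset.mem_univ (⟨0, by omega⟩ : Fin LT)), hb] at hsum
    rw [Finset.sum_congr rfl (g := fun _ => f w.1) fun i hi => ?_] at hsum
    · rw [Finset.sum_const, Finset.card_erase_of_mem (Finset.mem_univ _), Finset.card_univ,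
        Fintype.card_fin, nsmul_eq_mul, Nat.cast_sub (by omega), Nat.cast_one] at hsum
      rw [hc, eq_div_iff hLT']
      linarith
    · refine hunit ⟨b i, by simp⟩ w ?_ hw
      rw [← hb]
      exact b.inner_eq_zero (Finset.ne_of_mem_erase hi).symm
  have hperp : ∀ w, inner ℂ v.1 w = (0 : ℂ) → f w = c * ‖w‖ ^ 2 := by
    intro w hw
    by_cases h0 : w = 0
    · subst h0
      simp [f, secondMoment]
    · have hn : ‖w‖ ≠ 0 := norm_ne_zero_iff.2 h0
      let u : UnitVec LT := ⟨((‖w‖⁻¹ : ℝ) : ℂ) • w, by simp [norm_smul, hn]⟩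
      have hu : w = ((‖w‖ : ℝ) : ℂ) • u.1 := by
        simp [u, smul_smul, hn]
      have hperpu : inner ℂ v.1 u.1 = (0 : ℂ) := by simp [u, hw]
      conv_lhs => rw [hu]
      change secondMoment μ X _ = _
      rw [secondMoment_smul]
      change _ * f u.1 = _
      rw [hperp1 u hperpu]
      simp [mul_comm]
  set p : EuclideanSpace ℂ (Fin LT) := inner ℂ v.1 h • v.1
  set w := h - p
  have hw : inner ℂ v.1 w = (0 : ℂ) := by
    simp only [w, p, inner_sub_right, inner_smul_right, hvv, mul_one, sub_self]
  have hpn : ‖p‖ ^ 2 = ‖inner ℂ v.1 h‖ ^ 2 := by simp [p, norm_smul, v.norm_eq]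
  have hwn : ‖w‖ ^ 2 = ‖h‖ ^ 2 - ‖inner ℂ v.1 h‖ ^ 2 := by
    have h1 : h = p + w := by simp [w]
    have h2 : inner ℂ p w = (0 : ℂ) := by simp only [p, inner_smul_left, hw, mul_zero]
    have h3 : ‖h‖ ^ 2 = ‖p‖ ^ 2 + ‖w‖ ^ 2 := by
      conv_lhs => rw [h1]
      rw [norm_add_sq (𝕜 := ℂ), h2]
      simp
    rw [h3, hpn]
    ring
  -- Reflection in the complex line of `v` fixes `p` and negates `w`. With the parallelogram law
  -- this removes the cross term, so that f(p + w) = f(p) + f(w).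
  have hpw : f (p - w) = f (p + w) := by
    let U := (Submodule.span ℂ {v.1}).reflection
    have hUp : U p = p := Submodule.reflection_mem_subspace_eq_self
      (Submodule.smul_mem _ _ (Submodule.mem_span_singleton_self _))
    have hUw : U w = -w := Submodule.reflection_mem_subspace_orthogonalComplement_eq_neg
      (Submodule.mem_orthogonal_singleton_iff_inner_right.2 hw)
    have hUv : U v.1 = v.1 := Submodule.reflection_mem_subspace_eq_self
      (Submodule.mem_span_singleton_self _)
    rw [← hinv U hUv (p + w), map_add, hUp, hUw, sub_eq_add_neg]
  have hsum := secondMoment_add_add_sub (μ := μ) hX p w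
  have hfp : f p = ‖inner ℂ v.1 h‖ ^ 2 * f v.1 := secondMoment_smul _ _
  have hh : f h = f p + f w := by
    have h1 : h = p + w := by simp [w]
    change f (p + w) + f (p - w) = 2 * (f p + f w) at hsum
    rw [hpw] at hsum
    conv_lhs => rw [h1]
    linarith
  rw [hh, hfp, hperp w hw, hwn]
  ring

end SecondMoment

/-! ### Symmetries of the joint quantizer. -/

section Quantizer

variable {LT s K : ℕ}

/-- A symmetry of the codebooks that preserves the gains does not change the selected index, up to
ties. -/
lemma IsJointQuantizer.ae_eq_of_gain_eq {φ : Codebook LT s K → CompositeMatrix LT s → Fin K}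
    [NeZero LT] (hLT : 2 ≤ LT) (hs : 1 ≤ s) (hφ : IsJointQuantizer φ)
    {Φ : CompositeMatrix LT s → CompositeMatrix LT s} {V V' : CompositeMatrix LT s}
    (hg : ∀ b, gain V' (Φ b) = gain V b) :
    ∀ᵐ B ∂(codebookLaw LT s K), φ (fun j => Φ (B j)) V' = φ B V := by
  filter_upwards [ae_injective_gain hLT hs V] with B hB
  -- Both indices maximize the gain of `B` against `V`, and with distinct gains the maximizer is
  -- unique.
  refine hB (le_antisymm (hφ B V _) ?_)
  have := hφ (fun j => Φ (B j)) V' (φ B V)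
  rwa [hg, hg] at this

/-- The `k`-th column of the selected codeword. -/
def selectedColumn (φ : Codebook LT s K → CompositeMatrix LT s → Fin K)
    (V : CompositeMatrix LT s) (k : Fin s) (B : Codebook LT s K) : UnitVec LT :=
  B (φ B V) k

variable {φ : Codebook LT s K → CompositeMatrix LT s → Fin K}

lemma measurable_apply_apply : Measurable fun p : Codebook LT s K × Fin K => p.1 p.2 :=
  measurable_from_prod_countable_left fun i => measurable_pi_apply i

lemma measurable_selectedColumn
    (hm : Measurable fun p : Codebook LT s K × CompositeMatrix LT s => φ p.1 p.2)
    (V : CompositeMatrix LT s) (k : Fin s) : Measurable (selectedColumn φ V k) := by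
  have h1 : Measurable fun B : Codebook LT s K => φ B V :=
    hm.comp (measurable_id.prodMk measurable_const)
  exact (measurable_pi_apply k).comp (measurable_apply_apply.comp (measurable_id.prodMk h1))

/-- The action on the second moments of a symmetry of the codewords. -/
lemma secondMoment_selectedColumn_congr [NeZero LT] (hLT : 2 ≤ LT) (hs : 1 ≤ s)
    (hm : Measurable fun p : Codebook LT s K × CompositeMatrix LT s => φ p.1 p.2)
    (hφ : IsJointQuantizer φ) {Φ : CompositeMatrix LT s → CompositeMatrix LT s}
    (hΦ : MeasurePreserving Φ (isotropicComposite LT s) (isotropicComposite LT s))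
    {V V' : CompositeMatrix LT s} (hg : ∀ b, gain V' (Φ b) = gain V b) {k k' : Fin s}
    {h h' : EuclideanSpace ℂ (Fin LT)}
    (hk : ∀ b, ‖inner ℂ h' (Φ b k').1‖ = ‖inner ℂ h (b k).1‖) :
    secondMoment (codebookLaw LT s K) (selectedColumn φ V' k') h' =
      secondMoment (codebookLaw LT s K) (selectedColumn φ V k) h := by
  have hΨ : MeasurePreserving (fun (B : Codebook LT s K) j => Φ (B j)) (codebookLaw LT s K)
      (codebookLaw LT s K) := measurePreserving_pi _ _ fun _ => hΦ
  unfold secondMoment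
  -- Change of variables: on the left the codebook is replaced by its image under `Φ`, which has the
  -- same law.
  conv_lhs => rw [← hΨ.map_eq]
  rw [integral_map hΨ.measurable.aemeasurable]
  · refine integral_congr_ae ?_
    filter_upwards [hφ.ae_eq_of_gain_eq hLT hs hg] with B hB
    simp only [selectedColumn]
    rw [hB, hk]
  · rw [hΨ.map_eq]
    exact (integrable_inner_sq (measurable_selectedColumn hm V' k') h').aestronglyMeasurable

lemma secondMoment_selectedColumn_rotate [NeZero LT] (hLT : 2 ≤ LT) (hs : 1 ≤ s)
    (hm : Measurable fun p : Codebook LT s K × CompositeMatrix LT s => φ p.1 p.2)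
    (hφ : IsJointQuantizer φ)
    (U : Fin s → EuclideanSpace ℂ (Fin LT) ≃ₗᵢ[ℂ] EuclideanSpace ℂ (Fin LT))
    {V V' : CompositeMatrix LT s} (hV : ∀ k, U k (V k).1 = (V' k).1) (k : Fin s)
    (h : EuclideanSpace ℂ (Fin LT)) :
    secondMoment (codebookLaw LT s K) (selectedColumn φ V' k) (U k h) =
      secondMoment (codebookLaw LT s K) (selectedColumn φ V k) h := by
  refine secondMoment_selectedColumn_congr hLT hs hm hφ (Φ := fun b k => rotate (U k) (b k))
    (measurePreserving_pi _ _ fun k => measurePreserving_rotate (U k)) (fun b => ?_) fun b => ?_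
  · simp only [gain, rotate, ← hV, LinearIsometryEquiv.inner_map_map]
  · simp only [rotate, LinearIsometryEquiv.inner_map_map]

lemma secondMoment_selectedColumn_perm [NeZero LT] (hLT : 2 ≤ LT) (hs : 1 ≤ s)
    (hm : Measurable fun p : Codebook LT s K × CompositeMatrix LT s => φ p.1 p.2)
    (hφ : IsJointQuantizer φ) (τ : Equiv.Perm (Fin s)) (V : CompositeMatrix LT s) (k : Fin s)
    (h : EuclideanSpace ℂ (Fin LT)) :
    secondMoment (codebookLaw LT s K) (selectedColumn φ (fun i => V (τ i)) k) h =
      secondMoment (codebookLaw LT s K) (selectedColumn φ V (τ k)) h := by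
  refine secondMoment_selectedColumn_congr hLT hs hm hφ (Φ := fun b i => b (τ i)) ?_
    (fun b => ?_) fun b => rfl
  · exact measurePreserving_arrowCongr' (fun _ => isotropicVec LT) (fun _ => isotropicVec LT) τ.symm
      (MeasurableEquiv.refl _) fun _ => MeasurePreserving.id _
  · exact Equiv.sum_comp τ fun i => ‖inner ℂ (V i).1 (b i).1‖ ^ 2

/-- Swapping columns `k` and `k'` and then rotating each column carries `V` to `V'` and moves
position `k` to `k'`. Hence every column contributes the same share γ/s to the expected gain. -/
lemma secondMoment_selectedColumn_self_eq [NeZero LT] (hLT : 2 ≤ LT) (hs : 1 ≤ s)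
    (hm : Measurable fun p : Codebook LT s K × CompositeMatrix LT s => φ p.1 p.2)
    (hφ : IsJointQuantizer φ) (V V' : CompositeMatrix LT s) (k k' : Fin s) :
    secondMoment (codebookLaw LT s K) (selectedColumn φ V k) (V k).1 =
      secondMoment (codebookLaw LT s K) (selectedColumn φ V' k') (V' k').1 := by
  let τ := Equiv.swap k k'
  have hτ : τ k' = k := Equiv.swap_apply_right _ _
  have h1 := secondMoment_selectedColumn_perm hLT hs hm hφ τ V k' (V k).1
  rw [hτ] at h1
  rw [← h1]
  choose U hU using fun i => exists_rotate_eq hLT (V (τ i)) (V' i)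
  have h2 := secondMoment_selectedColumn_rotate hLT hs hm hφ U (V := fun i => V (τ i)) (V' := V')
    hU k' (V (τ k')).1
  rw [hU, hτ] at h2
  exact h2.symm

/-- The second moments of the columns of the selected codeword. -/
lemma secondMoment_selectedColumn_eq [NeZero LT] (hLT : 2 ≤ LT) (hs : 1 ≤ s)
    (hm : Measurable fun p : Codebook LT s K × CompositeMatrix LT s => φ p.1 p.2)
    (hφ : IsJointQuantizer φ) (V : CompositeMatrix LT s) (k : Fin s)
    (h : EuclideanSpace ℂ (Fin LT)) :
    secondMoment (codebookLaw LT s K) (selectedColumn φ V k) h =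
      secondMoment (codebookLaw LT s K) (selectedColumn φ V k) (V k).1 *
        ‖inner ℂ (V k).1 h‖ ^ 2 +
      (1 - secondMoment (codebookLaw LT s K) (selectedColumn φ V k) (V k).1) / (LT - 1) *
        (‖h‖ ^ 2 - ‖inner ℂ (V k).1 h‖ ^ 2) := by
  refine secondMoment_eq_of_invariant hLT (measurable_selectedColumn hm V k) (V k)
    (fun U hU h => ?_) h
  -- Only the `k`-th column is rotated; the others stay fixed, so `V` is unchanged.
  have := secondMoment_selectedColumn_rotate hLT hs hm hφ
    (fun i => if i = k then U else LinearIsometryEquiv.refl ℂ _) (V := V) (V' := V)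
    (fun i => by by_cases hi : i = k <;> simp [hi, hU]) k h
  simpa using this

/-- The expected gain of the selected codeword does not depend on `V`, and all columns contribute
equally. -/
lemma integral_gain_selected [NeZero LT] (hLT : 2 ≤ LT) (hs : 1 ≤ s)
    (hm : Measurable fun p : Codebook LT s K × CompositeMatrix LT s => φ p.1 p.2)
    (hφ : IsJointQuantizer φ) (V V' : CompositeMatrix LT s) (k : Fin s) :
    ∫ B, gain V (B (φ B V)) ∂(codebookLaw LT s K) =
      s * secondMoment (codebookLaw LT s K) (selectedColumn φ V' k) (V' k).1 := by
  change ∫ B, ∑ i, ‖inner ℂ (V i).1 (selectedColumn φ V i B).1‖ ^ 2 ∂(codebookLaw LT s K) = _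
  rw [integral_finsetSum _ fun i _ =>
    integrable_inner_sq (measurable_selectedColumn hm V i) (V i).1]
  refine (Finset.sum_congr rfl fun i _ =>
    secondMoment_selectedColumn_self_eq hLT hs hm hφ V V' i k).trans ?_
  simp

/-- The second-moment formula is summed over the conjugated rows h of `A`: the ‖h‖² add up to
`frobSq A`, and the |v† h|² to ‖A v‖², which is the top eigenvalue. -/
lemma integral_equivChannelSq_selected [NeZero LT] {LR : ℕ} (hLT : 2 ≤ LT) (hs : 1 ≤ s)
    (hm : Measurable fun p : Codebook LT s K × CompositeMatrix LT s => φ p.1 p.2)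
    (hφ : IsJointQuantizer φ) (V : CompositeMatrix LT s) (k : Fin s) (A : Channel LR LT)
    (hA : IsTopRightSingularVector A (V k)) :
    ∫ B, equivChannelSq A (B (φ B V) k) ∂(codebookLaw LT s K) =
      secondMoment (codebookLaw LT s K) (selectedColumn φ V k) (V k).1 * topEigenvalue A +
      (1 - secondMoment (codebookLaw LT s K) (selectedColumn φ V k) (V k).1) / (LT - 1) *
        (frobSq A - topEigenvalue A) := by
  simp_rw [equivChannelSq_eq_sum_inner]
  change ∫ B, ∑ i, ‖inner ℂ (conjRow A i) (selectedColumn φ V k B).1‖ ^ 2 ∂(codebookLaw LT s K) = _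
  rw [integral_finsetSum _ fun i _ =>
    integrable_inner_sq (measurable_selectedColumn hm V k) (conjRow A i)]
  refine (Finset.sum_congr rfl fun i _ =>
    secondMoment_selectedColumn_eq hLT hs hm hφ V k (conjRow A i)).trans ?_
  rw [← equivChannelSq_of_isTopRightSingularVector hA, equivChannelSq_eq_sum_inner,
    ← sum_norm_conjRow_sq, ← Finset.sum_sub_distrib, Finset.mul_sum, Finset.mul_sum,
    ← Finset.sum_add_distrib]
  simp_rw [norm_inner_symm (conjRow A _) (V k).1]

end Quantizer

/-! ### Integrability and assembly of the two averages. -/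

lemma equivChannelSq_nonneg {LR LT : ℕ} (A : Channel LR LT) (b : UnitVec LT) :
    0 ≤ equivChannelSq A b := Finset.sum_nonneg fun _ _ => sq_nonneg _

lemma equivChannelSq_le_frobSq {LR LT : ℕ} (A : Channel LR LT) (b : UnitVec LT) :
    equivChannelSq A b ≤ frobSq A := by
  rw [equivChannelSq_eq_sum_inner, ← sum_norm_conjRow_sq]
  refine Finset.sum_le_sum fun i _ => ?_
  have := norm_inner_le_norm (𝕜 := ℂ) (conjRow A i) b.1
  rw [b.norm_eq, mul_one] at this
  gcongr

lemma continuous_equivChannelSq {LR LT : ℕ} :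
    Continuous fun q : Channel LR LT × UnitVec LT => equivChannelSq q.1 q.2 := by
  have h : ∀ i, Continuous fun q : Channel LR LT × UnitVec LT => conjRow q.1 i := by
    intro i
    unfold conjRow
    fun_prop
  simp_rw [equivChannelSq_eq_sum_inner]
  fun_prop

lemma gain_nonneg {LT s : ℕ} (V B : CompositeMatrix LT s) : 0 ≤ gain V B :=
  Finset.sum_nonneg fun _ _ => sq_nonneg _

lemma gain_le {LT s : ℕ} (V B : CompositeMatrix LT s) : gain V B ≤ s := by
  have : gain V B ≤ ∑ _k : Fin s, (1 : ℝ) := by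
    refine Finset.sum_le_sum fun k _ => ?_
    have := norm_inner_le_norm (𝕜 := ℂ) (V k).1 (B k).1
    rw [(V k).norm_eq, (B k).norm_eq, mul_one] at this
    exact pow_le_one₀ (norm_nonneg _) this
  simpa using this

section Scheme

variable {N s LR LT K : ℕ} {sel : (Fin N → Channel LR LT) → Fin s → Fin N}
  {v : (Fin N → Channel LR LT) → CompositeMatrix LT s}
  {φ : Codebook LT s K → CompositeMatrix LT s → Fin K}

lemma measurable_selectedCodeword (hv : Measurable v)
    (hφ : Measurable fun p : Codebook LT s K × CompositeMatrix LT s => φ p.1 p.2) :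
    Measurable fun p : Codebook LT s K × (Fin N → Channel LR LT) => p.1 (φ p.1 (v p.2)) :=
  measurable_apply_apply.comp (measurable_fst.prodMk
    (hφ.comp (measurable_fst.prodMk (hv.comp measurable_snd))))

lemma integrable_selectedGain [NeZero LT] (hv : Measurable v)
    (hφ : Measurable fun p : Codebook LT s K × CompositeMatrix LT s => φ p.1 p.2) :
    Integrable (fun p : Codebook LT s K × (Fin N → Channel LR LT) => selectedGain v φ p.1 p.2)
      ((codebookLaw LT s K).prod (systemLaw N LR LT)) := by
  have hc : Continuous fun q : CompositeMatrix LT s × CompositeMatrix LT s => gain q.1 q.2 := by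
    unfold gain
    fun_prop
  refine Integrable.of_bound (hc.measurable.comp ((hv.comp measurable_snd).prodMk
    (measurable_selectedCodeword hv hφ))).aestronglyMeasurable s
    (Eventually.of_forall fun p => ?_)
  rw [selectedGain, Real.norm_of_nonneg (gain_nonneg _ _)]
  exact gain_le _ _

lemma integrable_frobSq_selected (hsel : Measurable sel) (k : Fin s) :
    Integrable (fun H => frobSq (H (sel H k))) (systemLaw N LR LT) :=
  integrable_comp_selected hsel continuous_frobSq.measurable frobSq_nonneg
    (integrable_frobSq LR LT) k

/-- Each term is dominated by the squared norm of the selected matrix, since codeword columns are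
unit vectors. -/
lemma integrable_totalPower [NeZero LT] (hsel : Measurable sel) (hv : Measurable v)
    (hφ : Measurable fun p : Codebook LT s K × CompositeMatrix LT s => φ p.1 p.2) :
    Integrable (fun p : Codebook LT s K × (Fin N → Channel LR LT) => totalPower sel v φ p.1 p.2)
      ((codebookLaw LT s K).prod (systemLaw N LR LT)) := by
  unfold totalPower
  refine integrable_finsetSum _ fun k _ => ?_
  refine ((integrable_frobSq_selected hsel k).comp_snd (codebookLaw LT s K)).mono'
    (continuous_equivChannelSq.measurable.comp (((measurable_selected hsel k).comp
      measurable_snd).prodMk ((measurable_pi_apply k).comp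
        (measurable_selectedCodeword hv hφ)))).aestronglyMeasurable
    (Eventually.of_forall fun p => ?_)
  rw [Real.norm_of_nonneg (equivChannelSq_nonneg _ _)]
  exact equivChannelSq_le_frobSq _ _

/-- The expectation of the total power over the random codebook, given the channels. -/
lemma integral_codebook_totalPower [NeZero LT] (hLT : 2 ≤ LT) (hs : 1 ≤ s)
    (hv_meas : Measurable v)
    (hv : ∀ H k, IsTopRightSingularVector (H (sel H k)) (v H k))
    (hφ_meas : Measurable fun p : Codebook LT s K × CompositeMatrix LT s => φ p.1 p.2)
    (hφ : IsJointQuantizer φ) (H : Fin N → Channel LR LT) :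
    ∫ B, totalPower sel v φ B H ∂(codebookLaw LT s K) =
      ∑ k, (expectedGain v φ / s * topEigenvalue (H (sel H k)) +
        (1 - expectedGain v φ / s) / (LT - 1) *
          (frobSq (H (sel H k)) - topEigenvalue (H (sel H k)))) := by
  have hgain : ∀ k : Fin s, expectedGain v φ / s =
      secondMoment (codebookLaw LT s K) (selectedColumn φ (v H) k) (v H k).1 := by
    intro k
    have h0 : (s : ℝ) ≠ 0 := by positivity
    unfold expectedGain
    -- The codebook is integrated first: the inner integral is the same for all channels, so
    -- averaging over them changes nothing.
    rw [integral_prod_symm _ (integrable_selectedGain hv_meas hφ_meas)]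
    simp only [selectedGain]
    simp_rw [fun H' => integral_gain_selected hLT hs hφ_meas hφ (v H') (v H) k]
    rw [integral_const]
    simp [h0]
  have hcol : ∀ k (A : Channel LR LT), Integrable
      (fun B => equivChannelSq A (B (φ B (v H)) k)) (codebookLaw LT s K) := by
    intro k A
    simp_rw [equivChannelSq_eq_sum_inner]
    exact integrable_finsetSum _ fun i _ =>
      integrable_inner_sq (measurable_selectedColumn hφ_meas (v H) k) (conjRow A i)
  unfold totalPower
  rw [integral_finsetSum _ fun k _ => hcol k _]
  refine Finset.sum_congr rfl fun k _ => ?_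
  rw [integral_equivChannelSq_selected hLT hs hφ_meas hφ (v H) k _ (hv H k), hgain k]

lemma integral_totalPower [NeZero LT] (hs : 1 ≤ s) (hLR : 1 ≤ LR) (hLT : 2 ≤ LT)
    (hsel_meas : Measurable sel) (hsel : ∀ H, IsUserSelection H (sel H)) (hv_meas : Measurable v)
    (hv : ∀ H k, IsTopRightSingularVector (H (sel H k)) (v H k))
    (hφ_meas : Measurable fun p : Codebook LT s K × CompositeMatrix LT s => φ p.1 p.2)
    (hφ : IsJointQuantizer φ) :
    ∫ p, totalPower sel v φ p.1 p.2 ∂((codebookLaw LT s K).prod (systemLaw N LR LT)) =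
      (expectedGain v φ / s * zetaOne LR LT +
        (1 - expectedGain v φ / s) / (LT - 1) * (1 - zetaOne LR LT)) *
      ∑ k, ∫ H, frobSq (H (sel H k)) ∂(systemLaw N LR LT) := by
  rw [integral_prod_symm _ (integrable_totalPower hsel_meas hv_meas hφ_meas)]
  simp_rw [integral_codebook_totalPower hLT hs hv_meas hv hφ_meas hφ]
  have h1 := fun k => integrable_frobSq_selected (LR := LR) (LT := LT) hsel_meas k
  have h2 : ∀ k, Integrable (fun H => topEigenvalue (H (sel H k))) (systemLaw N LR LT) := fun k =>
    integrable_comp_selected hsel_meas continuous_topEigenvalue.measurable topEigenvalue_nonneg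
      (integrable_topEigenvalue LR LT) k
  have h3 : ∀ a : ℝ, ∀ k, Integrable (fun H => a * topEigenvalue (H (sel H k)))
      (systemLaw N LR LT) := fun a k => (h2 k).const_mul a
  have h4 : ∀ a : ℝ, ∀ k, Integrable
      (fun H => a * (frobSq (H (sel H k)) - topEigenvalue (H (sel H k)))) (systemLaw N LR LT) :=
    fun a k => ((h1 k).sub (h2 k)).const_mul a
  rw [integral_finsetSum _ fun k _ => (h3 _ k).fun_add (h4 _ k), Finset.mul_sum]
  refine Finset.sum_congr rfl fun k _ => ?_
  rw [integral_add (h3 _ k) (h4 _ k), integral_const_mul, integral_const_mul,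
    integral_sub (h1 k) (h2 k), integral_topEigenvalue_selected hLR (by omega) hsel_meas hsel k]
  ring

end Scheme

end BeamForm

end

open BeamForm
theorem theorem5 (N s LR LT K : ℕ) (hs : 1 ≤ s) (hsN : s ≤ N) (hLR : 1 ≤ LR) (hLT : 2 ≤ LT)
    (hK : 1 ≤ K)
    (sel : (Fin N → Channel LR LT) → Fin s → Fin N) (hsel_meas : Measurable sel)
    (hsel : ∀ H, IsUserSelection H (sel H))
    (v : (Fin N → Channel LR LT) → CompositeMatrix LT s) (hv_meas : Measurable v)
    (hv : ∀ H k, IsTopRightSingularVector (H (sel H k)) (v H k))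
    (φ : Codebook LT s K → CompositeMatrix LT s → Fin K)
    (hφ_meas : Measurable fun p : Codebook LT s K × CompositeMatrix LT s => φ p.1 p.2)
    (hφ : IsJointQuantizer φ) :
    -- the conditional expectation of the top eigenvalue given unit trace exists, and it is the
    -- factor of proportionality in the conditional expectation given the trace
    Tendsto
      (fun ε : ℝ => ⨍ A in {A : Channel LR LT | |wishartTrace A - 1| < ε},
        topEigenvalue A ∂(channelLaw LR LT))
      (𝓝[>] 0) (𝓝 (zetaOne LR LT)) ∧
    Integrable (topEigenvalue (LR := LR) (LT := LT)) (channelLaw LR LT) ∧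
    (channelLaw LR LT)[topEigenvalue (LR := LR) (LT := LT) |
        MeasurableSpace.comap (wishartTrace (LR := LR) (LT := LT)) inferInstance]
      =ᵐ[channelLaw LR LT] (fun A => zetaOne LR LT * wishartTrace A) ∧
    -- all the expectations exist
    (∀ k, Integrable (fun H => frobSq (H (sel H k))) (systemLaw N LR LT)) ∧
    Integrable (fun p : Codebook LT s K × (Fin N → Channel LR LT) => selectedGain v φ p.1 p.2)
      ((codebookLaw LT s K).prod (systemLaw N LR LT)) ∧
    Integrable (fun p : Codebook LT s K × (Fin N → Channel LR LT) => totalPower sel v φ p.1 p.2)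
      ((codebookLaw LT s K).prod (systemLaw N LR LT)) ∧
    Integrable (powerEfficiency sel v φ) (codebookLaw LT s K) ∧
    -- the expected power efficiency factor
    ∫ B, powerEfficiency sel v φ B ∂(codebookLaw LT s K) =
      1 / (s * LR) * ∫ p, totalPower sel v φ p.1 p.2
        ∂((codebookLaw LT s K).prod (systemLaw N LR LT)) ∧
    ∫ B, powerEfficiency sel v φ B ∂(codebookLaw LT s K) =
      1 / LR * (expectedGain v φ / s * zetaOne LR LT +
        (s - expectedGain v φ) / s * ((1 - zetaOne LR LT) / (LT - 1))) * meanSelectedSq sel := by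
  have : NeZero LT := ⟨by omega⟩
  have hprod := integrable_totalPower (N := N) (LR := LR) hsel_meas hv_meas hφ_meas
  have heff : ∫ B, powerEfficiency sel v φ B ∂(codebookLaw LT s K) =
      1 / (s * LR) * ∫ p, totalPower sel v φ p.1 p.2
        ∂((codebookLaw LT s K).prod (systemLaw N LR LT)) := by
    simp only [powerEfficiency]
    rw [integral_const_mul, integral_prod _ hprod]
  refine ⟨(tendsto_zetaOne_and_lintegral hLR (by omega)).1, integrable_topEigenvalue LR LT,
    condExp_topEigenvalue hLR (by omega), integrable_frobSq_selected hsel_meas,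
    integrable_selectedGain hv_meas hφ_meas, hprod, hprod.integral_prod_left.const_mul _, heff, ?_⟩
  rw [heff, integral_totalPower hs hLR hLT hsel_meas hsel hv_meas hv hφ_meas hφ, meanSelectedSq]
  have h1 : (s : ℝ) ≠ 0 := by positivity
  have h2 : (LR : ℝ) ≠ 0 := by positivity
  have h3 : (LT : ℝ) - 1 ≠ 0 := by
    have : (2 : ℝ) ≤ LT := by exact_mod_cast hLT
    linarith
  field_simp
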